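/- Let $k$ be a field with the trivial absolute value. All logarithmic schemes below are fine and saturated Zariski logarithmic schemes $X=(X,M_X)$ of finite type over $k$ which admit a characteristic morphism, i.e. a strict morphism $\phi_X\colon (X,\overline M_X)\to F_X$ of sharp monoidal spaces, $\overline M_X=M_X/M_X^\ast$, into a fine and saturated Kato fan $F_X$ such that every strict morphism from $(X,\overline M_X)$ to a fine and saturated Kato fan factors through $\phi_X$ by a unique strict morphism from $F_X$; it is then unique up to unique isomorphism. We also write $\phi_X$ for the composition $(X,\overline{\mathcal O}_X)\to (X,\overline M_X)\to F_X$, $\overline{\mathcal O}_X=\mathcal O_X/\mathcal O_X^\ast$. Let $\overline\Sigma_X=F_X(\overline{\mathbb R}_{\ge 0})$ be the set of morphisms $u\colon \operatorname{Spec}\overline{\mathbb R}_{\ge0}\to F_X$, where $\overline{\mathbb R}_{\ge0}=[0,\infty]$ is an additive monoid, with the weak topology defined by the extended cones $\operatorname{Hom}(P,\overline{\mathbb R}_{\ge0})$ of the open affine subsets $\operatorname{Spec}P\subseteq F_X$, and with the reduction map $r(u)=u((0,\infty])$ and the structure map $\rho(u)=u(\{\infty\})$. Let $X^\beth$ be Thuillier's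 analytic space, glued from the spaces $(\operatorname{Spec}A)^\beth$ of multiplicative seminorms on $A$ bounded by $1$, for $\operatorname{Spec}A\subseteq X$ open, with $r,\rho\colon X^\beth\to X$ given by $r(x)=\{f\colon |f|_x<1\}$ and $\rho(x)=\{f\colon|f|_x=0\}$. (i) There is a well-defined map $\operatorname{trop}_X\colon X^\beth\to\overline\Sigma_X$ which sends the point represented by any morphism $\operatorname{Spec}R\to X$, $R$ the valuation ring of a field extension of $k$ with a real-valued non-Archimedean absolute value that is trivial on $k$, to the composition $\operatorname{Spec}\overline{\mathbb R}_{\ge0}\to\operatorname{Spec}R\to(X,\overline{\mathcal O}_X)\to F_X$ with first arrow induced by $\operatorname{val}=-\log|\cdot|$; that is, to the unique $u$ which sends the closed point $(0,\infty]$ to $\phi_X(r(x))$ and whose homomorphism of stalks there is the composition $\mathcal O_{F_X,\phi_X(r(x))}\to\overline{\mathcal O}_{X,r(x)}\to R/R^\ast\to\overline{\mathbb R}_{\ge0}$. The map $\operatorname{trop}_X$ is continuous, and $$r\circ\operatorname{trop}_X=\phi_X\circ r,\qquad \rho\circ\operatorname{trop}_X=\phi_X\circ\rho .$$ (ii) Every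 morphism $f\colon X\to X'$ of such logarithmic schemes over $k$ induces a unique morphism of Kato fans $f^F\colon F_X\to F_{X'}$ compatible with the characteristic morphisms on $(X,\overline M_X)$ and $(X',\overline M_{X'})$; it is also compatible with those on $(X,\overline{\mathcal O}_X)$ and $(X',\overline{\mathcal O}_{X'})$. The induced map $\overline\Sigma(f)\colon\overline\Sigma_X\to\overline\Sigma_{X'}$, $u\mapsto f^F\circ u$, is continuous and piecewise $\mathbb Z$-linear and satisfies $$\overline\Sigma(f)\circ\operatorname{trop}_X=\operatorname{trop}_{X'}\circ f^\beth .$$ The associations $f\mapsto f^F$ and $f\mapsto\overline\Sigma(f)$ are functorial: identities go to identities and compositions to compositions. -/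

import Mathlib

open scoped NNReal ENNReal Topology
open TopologicalSpace AlgebraicGeometry CategoryTheory

universe u v w

namespace LogTrop

noncomputable section

/-! ## Commutative monoids (written multiplicatively) -/

/-- A monoid is fine and saturated: finitely generated, `P → P^gp` is injective, and an element of
`P^gp` with a positive power in `P` lies in `P`. -/
structure IsFSMonoid (P : Type u) [CommMonoid P] : Prop where
  fg : Monoid.FG P
  integral : Function.Injective (Algebra.GrothendieckGroup.of (M := P))
  saturated : ∀ (g : Algebra.GrothendieckGroup P) (n : ℕ), 0 < n →
    g ^ n ∈ Set.range (Algebra.GrothendieckGroup.of (M := P)) →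
    g ∈ Set.range (Algebra.GrothendieckGroup.of (M := P))

/-- The homomorphism `M/M^* → N/N^*` induced by `f : M → N`. (`Associates M` is `M/M^*`.) -/
def barMap {M : Type u} {N : Type v} [CommMonoid M] [CommMonoid N] (f : M →* N) :
    Associates M →* Associates N where
  toFun := Quotient.map f fun _ _ h => h.map f
  map_one' := congrArg Associates.mk f.map_one
  map_mul' := by
    rintro ⟨a⟩ ⟨b⟩
    exact congrArg Associates.mk (f.map_mul a b)

@[simp] lemma barMap_mk {M : Type u} {N : Type v} [CommMonoid M] [CommMonoid N] (f : M →* N)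
    (a : M) : barMap f (Associates.mk a) = Associates.mk (f a) := rfl

/-- The homomorphism `M/M^* → N` induced by `f : M → N` into a sharp monoid `N`. -/
def barLift {M : Type u} {N : Type v} [CommMonoid M] [CommMonoid N] [Subsingleton Nˣ]
    (f : M →* N) : Associates M →* N where
  toFun := Quotient.lift f fun _ _ h => associated_iff_eq.mp (h.map f)
  map_one' := f.map_one
  map_mul' := by
    rintro ⟨a⟩ ⟨b⟩
    exact f.map_mul a b

@[simp] lemma barLift_mk {M : Type u} {N : Type v} [CommMonoid M] [CommMonoid N]
    [Subsingleton Nˣ] (f : M →* N) (a : M) : barLift f (Associates.mk a) = f a := rfl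

lemma isLocalHom_barMap {M : Type u} {N : Type v} [CommMonoid M] [CommMonoid N] (f : M →* N)
    (hf : IsLocalHom f) : IsLocalHom (barMap f) := by
  refine ⟨?_⟩
  rintro ⟨a⟩ h
  exact Associates.isUnit_mk.mpr (hf.map_nonunit a (Associates.isUnit_mk.mp h))

/-! ## Sheaves of monoids and locally monoidal spaces -/

/-- A sheaf of commutative monoids on a topological space, given by its étalé space: the stalks,
and for every point `x` the families `s ∈ ∏ y, stalk y` that are (the germs of) a section on some
neighbourhood of `x`; only the values of `s` close to `x` matter. The sections over an open set `U`
are the families over `U` that are sections near every point of `U`. -/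
structure MonoidSheaf (X : Type u) [TopologicalSpace X] where
  stalk : X → Type u
  [commMonoid : ∀ x, CommMonoid (stalk x)]
  IsSectionAt : X → (∀ x, stalk x) → Prop
  eventually_isSectionAt : ∀ {x s}, IsSectionAt x s → ∀ᶠ y in 𝓝 x, IsSectionAt y s
  congr : ∀ {x s t}, (∀ᶠ y in 𝓝 x, s y = t y) → IsSectionAt x s → IsSectionAt x t
  exists_section : ∀ {x} (m : stalk x), ∃ s, IsSectionAt x s ∧ s x = m
  eventually_eq : ∀ {x s t}, IsSectionAt x s → IsSectionAt x t → s x = t x →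
    ∀ᶠ y in 𝓝 x, s y = t y
  isSectionAt_one : ∀ x, IsSectionAt x 1
  isSectionAt_mul : ∀ {x s t}, IsSectionAt x s → IsSectionAt x t → IsSectionAt x (s * t)

attribute [instance] MonoidSheaf.commMonoid

/-- The quotient sheaf `M/M^*`. -/
abbrev MonoidSheaf.bar {X : Type u} [TopologicalSpace X] (M : MonoidSheaf X) : MonoidSheaf X where
  stalk x := Associates (M.stalk x)
  IsSectionAt x s := ∃ t, M.IsSectionAt x t ∧ ∀ᶠ y in 𝓝 x, s y = Associates.mk (t y)
  eventually_isSectionAt := by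
    rintro x s ⟨t, ht, h⟩
    filter_upwards [M.eventually_isSectionAt ht, h.eventually_nhds] with y h1 h2
    exact ⟨t, h1, h2⟩
  congr := by
    rintro x s s' h ⟨t, ht, h'⟩
    exact ⟨t, ht, by filter_upwards [h, h'] with y h1 h2; rw [← h1, h2]⟩
  exists_section := by
    rintro x ⟨m⟩
    obtain ⟨t, ht, rfl⟩ := M.exists_section m
    exact ⟨fun y => Associates.mk (t y), ⟨t, ht, .of_forall fun _ => rfl⟩, rfl⟩
  eventually_eq := by
    rintro x s s' ⟨t, ht, h⟩ ⟨t', ht', h'⟩ e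
    have e' : Associates.mk (t x) = Associates.mk (t' x) := by
      rw [← h.self_of_nhds, ← h'.self_of_nhds, e]
    obtain ⟨c, hc⟩ := Associates.mk_eq_mk_iff_associated.mp e'
    obtain ⟨a, ha, ha'⟩ := M.exists_section (c : M.stalk x)
    obtain ⟨b, hb, hb'⟩ := M.exists_section ((c⁻¹ : (M.stalk x)ˣ) : M.stalk x)
    have h1 := M.eventually_eq (M.isSectionAt_mul ha hb) (M.isSectionAt_one x)
      (by simp [ha', hb'])
    have h2 := M.eventually_eq (M.isSectionAt_mul ht ha) ht' (by simp [ha', hc])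
    filter_upwards [h, h', h1, h2] with y k k' k1 k2
    rw [k, k', ← k2]
    refine Associates.mk_eq_mk_iff_associated.mpr ⟨⟨a y, b y, k1, ?_⟩, rfl⟩
    rw [mul_comm]
    exact k1
  isSectionAt_one x := ⟨1, M.isSectionAt_one x, .of_forall fun _ => rfl⟩
  isSectionAt_mul := by
    rintro x s s' ⟨t, ht, h⟩ ⟨t', ht', h'⟩
    refine ⟨t * t', M.isSectionAt_mul ht ht', ?_⟩
    filter_upwards [h, h'] with y k k'
    simp [k, k', Associates.mk_mul_mk]

/-- A (locally) monoidal space: a topological space with a sheaf of commutative monoids. -/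
structure MonoidalSpace where
  carrier : Type u
  [top : TopologicalSpace carrier]
  sheaf : MonoidSheaf carrier

namespace MonoidalSpace

instance : CoeSort MonoidalSpace.{u} (Type u) := ⟨carrier⟩

attribute [instance] MonoidalSpace.top

/-- The stalk `O_{X,x}`. -/
abbrev stalk (X : MonoidalSpace.{u}) (x : X) : Type u := X.sheaf.stalk x

/-- A monoidal space is sharp if the only unit in each stalk is `1`. -/
def IsSharp (X : MonoidalSpace.{u}) : Prop := ∀ x : X, Subsingleton (X.stalk x)ˣ

/-- A morphism of locally monoidal spaces: a continuous map together with local homomorphisms on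
the stalks which take local sections to local sections. -/
@[ext] structure Hom (X : MonoidalSpace.{u}) (Y : MonoidalSpace.{v}) where
  toFun : X → Y
  continuous_toFun : Continuous toFun
  stalkMap : ∀ x, Y.stalk (toFun x) →* X.stalk x
  isLocalHom_stalkMap : ∀ x, IsLocalHom (stalkMap x)
  map_section : ∀ (x : X) (s : ∀ y, Y.stalk y), Y.sheaf.IsSectionAt (toFun x) s →
    X.sheaf.IsSectionAt x fun z => stalkMap z (s (toFun z))

instance (X : MonoidalSpace.{u}) (Y : MonoidalSpace.{v}) : CoeFun (Hom X Y) fun _ => X → Y :=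
  ⟨Hom.toFun⟩

namespace Hom

/-- The identity morphism. -/
def id (X : MonoidalSpace.{u}) : Hom X X where
  toFun := _root_.id
  continuous_toFun := continuous_id
  stalkMap _ := MonoidHom.id _
  isLocalHom_stalkMap _ := ⟨fun _ h => h⟩
  map_section _ _ h := h

/-- The composition `g ∘ f`. -/
def comp {X : MonoidalSpace.{u}} {Y : MonoidalSpace.{v}} {Z : MonoidalSpace.{w}}
    (g : Hom Y Z) (f : Hom X Y) : Hom X Z where
  toFun := g ∘ f
  continuous_toFun := g.continuous_toFun.comp f.continuous_toFun
  stalkMap x := (f.stalkMap x).comp (g.stalkMap (f x))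
  isLocalHom_stalkMap x := ⟨fun a h =>
    (g.isLocalHom_stalkMap (f x)).map_nonunit a ((f.isLocalHom_stalkMap x).map_nonunit _ h)⟩
  map_section x s h := f.map_section x _ (g.map_section (f x) s h)

/-- A morphism is strict if `f⁻¹ O_Y → O_X` is an isomorphism, i.e. bijective on all stalks. -/
def IsStrict {X : MonoidalSpace.{u}} {Y : MonoidalSpace.{v}} (f : Hom X Y) : Prop :=
  ∀ x, Function.Bijective (f.stalkMap x)

/-- An open immersion: an isomorphism onto an open subspace. -/
structure IsOpenImmersion {X : MonoidalSpace.{u}} {Y : MonoidalSpace.{v}} (f : Hom X Y) :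
    Prop where
  isOpenEmbedding : Topology.IsOpenEmbedding f
  isStrict : f.IsStrict

end Hom

end MonoidalSpace

open MonoidalSpace

/-! ## The spectrum of a monoid -/

/-- A prime ideal of a monoid (possibly empty): a subset stable under multiplication by all
elements whose complement is a submonoid. -/
@[ext] structure PrimeIdeal (P : Type u) [CommMonoid P] where
  carrier : Set P
  mul_mem : ∀ a {b}, b ∈ carrier → a * b ∈ carrier
  one_notMem : (1 : P) ∉ carrier
  mem_or_mem : ∀ {a b}, a * b ∈ carrier → a ∈ carrier ∨ b ∈ carrier

namespace PrimeIdeal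

variable {P : Type u} [CommMonoid P] {Q : Type v} [CommMonoid Q]

/-- The complement of a prime ideal. -/
def face (p : PrimeIdeal P) : Submonoid P where
  carrier := p.carrierᶜ
  one_mem' := p.one_notMem
  mul_mem' := fun ha hb h => (p.mem_or_mem h).elim ha hb

lemma mem_face {p : PrimeIdeal P} {a : P} : a ∈ p.face ↔ a ∉ p.carrier := Iff.rfl

lemma mem_face_of_mul {p : PrimeIdeal P} {a b : P} (h : a * b ∈ p.face) : b ∈ p.face :=
  fun hb => h (p.mul_mem a hb)

/-- The preimage of a prime ideal. -/
def comap (f : P →* Q) (q : PrimeIdeal Q) : PrimeIdeal P where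
  carrier := f ⁻¹' q.carrier
  mul_mem a b hb := by
    rw [Set.mem_preimage, map_mul]
    exact q.mul_mem _ hb
  one_notMem := by
    rw [Set.mem_preimage, map_one]
    exact q.one_notMem
  mem_or_mem {a b} h := by
    rw [Set.mem_preimage, map_mul] at h
    exact q.mem_or_mem h

/-- The basic set `D(f)` of prime ideals not containing `f`. -/
def basicOpen (f : P) : Set (PrimeIdeal P) := {p | f ∉ p.carrier}

/-- The topology on the set of prime ideals generated by the sets `D(f)`. -/
instance : TopologicalSpace (PrimeIdeal P) := generateFrom (Set.range basicOpen)

lemma isOpen_basicOpen (f : P) : IsOpen (basicOpen f) := isOpen_generateFrom_of_mem ⟨f, rfl⟩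

lemma continuous_comap (f : P →* Q) : Continuous (comap f) := by
  refine continuous_generateFrom_iff.mpr ?_
  rintro _ ⟨a, rfl⟩
  exact isOpen_basicOpen (f a)

/-- The stalk `P_p/P_p^*` of the structure sheaf of `Spec P`. -/
abbrev Stalk (p : PrimeIdeal P) : Type u := Associates (Localization p.face)

/-- The canonical homomorphism `P → P_p/P_p^*`. -/
def toStalk (p : PrimeIdeal P) : P →* p.Stalk :=
  Associates.mkMonoidHom.comp (Localization.monoidOf p.face).toMonoidHom

lemma isUnit_mk_of_mem_face (p : PrimeIdeal P) (b : p.face) :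
    IsUnit (Localization.mk (1 : P) b) := by
  refine IsUnit.of_mul_eq_one (Localization.mk (b : P) 1) ?_
  rw [Localization.mk_mul, one_mul, mul_one, Localization.mk_self]

lemma mk_mk (p : PrimeIdeal P) (a : P) (b : p.face) :
    Associates.mk (Localization.mk a b) = p.toStalk a := by
  have h : Localization.mk a b = Localization.mk a 1 * Localization.mk 1 b := by
    rw [Localization.mk_mul, mul_one, one_mul]
  rw [h, ← Associates.mk_mul_mk,
    Associates.mk_eq_one.mpr (isUnit_mk_of_mem_face p b), mul_one]
  rfl

lemma toStalk_surjective (p : PrimeIdeal P) : Function.Surjective p.toStalk := by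
  rintro ⟨m⟩
  induction m using Localization.induction_on with
  | H y => exact ⟨y.1, (mk_mk p y.1 y.2).symm⟩

lemma isUnit_toStalk {p : PrimeIdeal P} {a : P} : IsUnit (p.toStalk a) ↔ a ∈ p.face := by
  constructor
  · intro h
    obtain ⟨c, hc⟩ := (Associates.isUnit_mk.mp h).exists_right_inv
    induction c using Localization.induction_on with
    | H y =>
      have h1 : Localization.mk a 1 * Localization.mk y.1 y.2 = Localization.mk 1 1 := by
        rw [Localization.mk_one]; exact hc
      rw [Localization.mk_mul, Localization.mk_eq_mk_iff, Localization.r_iff_exists] at h1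
      obtain ⟨t, ht⟩ := h1
      have h2 : (t : P) * (y.1 * a) ∈ p.face := by
        have : (t : P) * (y.1 * a) = t * (y.2 : P) := by simpa [mul_comm] using ht
        rw [this]
        exact p.face.mul_mem t.2 y.2.2
      exact mem_face_of_mul (mem_face_of_mul h2)
  · intro h
    refine Associates.isUnit_mk.mpr ?_
    exact (Localization.monoidOf p.face).map_units ⟨a, h⟩

lemma toStalk_eq_iff {p : PrimeIdeal P} {a b : P} :
    p.toStalk a = p.toStalk b ↔ ∃ c ∈ p.face, ∃ d ∈ p.face, c * a = d * b := by
  constructor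
  · intro h
    obtain ⟨e, he⟩ := Associates.mk_eq_mk_iff_associated.mp h
    obtain ⟨e, e', h1, h2⟩ := e
    have hu : IsUnit e := ⟨⟨e, e', h1, h2⟩, rfl⟩
    induction e using Localization.induction_on with
    | H y =>
      have hy : y.1 ∈ p.face := isUnit_toStalk.mp (by
        rw [← mk_mk p y.1 y.2]
        exact Associates.isUnit_mk.mpr hu)
      have h3 : Localization.mk a 1 * Localization.mk y.1 y.2 = Localization.mk b 1 := he
      rw [Localization.mk_mul, Localization.mk_eq_mk_iff, Localization.r_iff_exists] at h3
      obtain ⟨t, ht⟩ := h3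
      refine ⟨t * y.1, p.face.mul_mem t.2 hy, t * y.2, p.face.mul_mem t.2 y.2.2, ?_⟩
      simpa [mul_comm, mul_left_comm, mul_assoc] using ht
  · rintro ⟨c, hc, d, hd, h⟩
    have h' := congrArg p.toStalk h
    rw [map_mul, map_mul, Associates.isUnit_iff_eq_one _ |>.mp (isUnit_toStalk.mpr hc),
      Associates.isUnit_iff_eq_one _ |>.mp (isUnit_toStalk.mpr hd), one_mul, one_mul] at h'
    exact h'

/-- The homomorphism of stalks induced by a homomorphism of monoids. -/
def stalkMap (f : P →* Q) (q : PrimeIdeal Q) : (comap f q).Stalk →* q.Stalk :=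
  barMap ((Localization.monoidOf (comap f q).face).lift
    (g := (Localization.monoidOf q.face).toMonoidHom.comp f)
    fun y => (Localization.monoidOf q.face).map_units ⟨f y, y.2⟩)

lemma stalkMap_toStalk (f : P →* Q) (q : PrimeIdeal Q) (a : P) :
    stalkMap f q ((comap f q).toStalk a) = q.toStalk (f a) := by
  refine congrArg Associates.mk ?_
  exact (Localization.monoidOf (comap f q).face).lift_eq _ a

end PrimeIdeal

open PrimeIdeal in
/-- The spectrum of a monoid. The sections over `D(f)` are `P_f/P_f^*`; since denominators become
units, every section is locally the image of an element of `P`. -/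
abbrev Spec (P : Type u) [CommMonoid P] : MonoidalSpace.{u} where
  carrier := PrimeIdeal P
  sheaf :=
    { stalk := fun p => p.Stalk
      IsSectionAt := fun p s => ∃ a : P, ∀ᶠ q in 𝓝 p, s q = q.toStalk a
      eventually_isSectionAt := by
        rintro p s ⟨a, h⟩
        filter_upwards [h.eventually_nhds] with q hq
        exact ⟨a, hq⟩
      congr := by
        rintro p s t h ⟨a, h'⟩
        exact ⟨a, by filter_upwards [h, h'] with q h1 h2; rw [← h1, h2]⟩
      exists_section := by
        intro p m
        obtain ⟨a, rfl⟩ := p.toStalk_surjective m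
        exact ⟨fun q => q.toStalk a, ⟨a, .of_forall fun _ => rfl⟩, rfl⟩
      eventually_eq := by
        rintro p s t ⟨a, ha⟩ ⟨b, hb⟩ e
        rw [ha.self_of_nhds, hb.self_of_nhds] at e
        obtain ⟨c, hc, d, hd, h⟩ := toStalk_eq_iff.mp e
        filter_upwards [ha, hb, (isOpen_basicOpen c).mem_nhds hc,
          (isOpen_basicOpen d).mem_nhds hd] with q h1 h2 h3 h4
        rw [h1, h2]
        exact toStalk_eq_iff.mpr ⟨c, h3, d, h4, h⟩
      isSectionAt_one := fun p => ⟨1, .of_forall fun q => (map_one q.toStalk).symm⟩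
      isSectionAt_mul := by
        rintro p s t ⟨a, ha⟩ ⟨b, hb⟩
        refine ⟨a * b, ?_⟩
        filter_upwards [ha, hb] with q h1 h2
        simp [h1, h2] }

open PrimeIdeal in
/-- The morphism `Spec Q → Spec P` induced by a homomorphism `P → Q`. -/
def Spec.map {P : Type u} [CommMonoid P] {Q : Type v} [CommMonoid Q] (f : P →* Q) :
    Hom (Spec Q) (Spec P) where
  toFun := comap f
  continuous_toFun := continuous_comap f
  stalkMap q := PrimeIdeal.stalkMap f q
  isLocalHom_stalkMap q := ⟨fun m h => by
    obtain ⟨a, rfl⟩ := (comap f q).toStalk_surjective m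
    rw [PrimeIdeal.stalkMap_toStalk] at h
    exact isUnit_toStalk.mpr (isUnit_toStalk.mp h : f a ∈ q.face)⟩
  map_section := by
    rintro q s ⟨a, ha⟩
    refine ⟨f a, ?_⟩
    filter_upwards [(continuous_comap f).continuousAt.eventually ha] with z hz
    rw [hz]
    exact PrimeIdeal.stalkMap_toStalk f z a

/-! ## Kato fans -/

/-- A Kato fan: a sharp monoidal space in which every point has an open neighbourhood isomorphic
to the spectrum of a monoid. -/
structure IsKatoFan (F : MonoidalSpace.{u}) : Prop where
  isSharp : F.IsSharp
  exists_affine : ∀ x : F, ∃ (P : Type u) (_ : CommMonoid P) (j : Hom (Spec P) F),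
    j.IsOpenImmersion ∧ x ∈ Set.range j

/-- A Kato fan is fine and saturated if it is quasi-compact and each of its open affine subsets
is the spectrum of a fine and saturated monoid. -/
structure IsFSKatoFan (F : MonoidalSpace.{u}) : Prop extends IsKatoFan F where
  compactSpace : CompactSpace F
  affine_fs : ∀ (P : Type u) [CommMonoid P] (j : Hom (Spec P) F), j.IsOpenImmersion →
    ∃ (Q : Type u) (_ : CommMonoid Q) (j' : Hom (Spec Q) F),
      IsFSMonoid Q ∧ j'.IsOpenImmersion ∧ Set.range j' = Set.range j

/-! ## Extended cone complexes -/

/-- The monoid `[0,∞]` of extended non-negative reals under addition, written multiplicatively. -/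
abbrev RBar : Type := Multiplicative ℝ≥0∞

lemma RBar.eq_one_of_mul {a b : RBar} (h : a * b = 1) : a = 1 :=
  (add_eq_zero.mp (show a.toAdd + b.toAdd = 0 from h)).1

instance : Subsingleton RBarˣ :=
  ⟨fun a b => Units.ext ((RBar.eq_one_of_mul a.mul_inv).trans (RBar.eq_one_of_mul b.mul_inv).symm)⟩

/-- The maximal ideal `(0,∞]`, the closed point of `Spec [0,∞]`. -/
def closedPt : Spec RBar :=
  show PrimeIdeal RBar from
  { carrier := {a | a ≠ 1}
    mul_mem := fun a b hb h => hb (RBar.eq_one_of_mul ((mul_comm b a).trans h))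
    one_notMem := fun h => h rfl
    mem_or_mem := by
      intro a b h
      by_contra! hc
      simp only [Set.mem_ofPred_eq, not_not] at hc
      exact h (by rw [hc.1, hc.2, one_mul]) }

/-- The prime ideal `{∞}` of `[0,∞]`. -/
def inftyPt : Spec RBar :=
  show PrimeIdeal RBar from
  { carrier := {a | a.toAdd = ∞}
    mul_mem := fun a b hb => by
      show a.toAdd + b.toAdd = ∞
      rw [show b.toAdd = ∞ from hb, add_top]
    one_notMem := ENNReal.zero_ne_top
    mem_or_mem := fun {a b} h => ENNReal.add_eq_top.mp (show a.toAdd + b.toAdd = ∞ from h) }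

/-- The canonical isomorphism from `[0,∞]` onto the stalk of `Spec [0,∞]` at the closed point. -/
def toClosedStalk : RBar →* (Spec RBar).stalk closedPt :=
  PrimeIdeal.toStalk (P := RBar) closedPt

/-- The set `F([0,∞])` of morphisms `Spec [0,∞] → F`: the extended cone complex of `F`. -/
def ExtCone (F : MonoidalSpace.{u}) : Type u := Hom (Spec RBar) F

namespace ExtCone

/-- The reduction map `u ↦ u((0,∞])`. -/
def red {F : MonoidalSpace.{u}} (x : ExtCone F) : F := Hom.toFun x closedPt

/-- The structure map `u ↦ u({∞})`. -/
def str {F : MonoidalSpace.{u}} (x : ExtCone F) : F := Hom.toFun x inftyPt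

/-- The map `Hom(P,[0,∞]) → F([0,∞])` given by a morphism `j : Spec P → F`; if `j` is an open
immersion with image `U`, this is the inclusion of the extended cone `r⁻¹(U)`. -/
def cone {F : MonoidalSpace.{u}} {P : Type u} [CommMonoid P] (j : Hom (Spec P) F)
    (h : P →* RBar) : ExtCone F := j.comp (Spec.map h)

/-- The topology of pointwise convergence on `Hom(P,[0,∞])`. -/
abbrev homTopology (P : Type u) [CommMonoid P] : TopologicalSpace (P →* RBar) :=
  TopologicalSpace.induced (fun h (p : P) => (h p).toAdd) Pi.topologicalSpace

/-- The weak topology: a set is closed (equivalently, open) if and only if so are its intersections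
with the extended cones of all open affine subsets. -/
instance (F : MonoidalSpace.{u}) : TopologicalSpace (ExtCone F) :=
  ⨆ (P : Type u) (_ : CommMonoid P) (j : Hom (Spec P) F) (_ : j.IsOpenImmersion),
    (homTopology P).coinduced (cone j)

/-- The map of extended cone complexes `u ↦ f ∘ u` induced by a morphism `f`. -/
def map {F G : MonoidalSpace.{u}} (f : Hom F G) (x : ExtCone F) : ExtCone G := Hom.comp f x

/-- A map of extended cone complexes is piecewise `ℤ`-linear if it takes the extended cone
`Hom(P,[0,∞])` of every open affine `Spec P` (`P` sharp, fine and saturated) into the extended cone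
`Hom(Q,[0,∞])` of an open affine `Spec Q`, by the map induced by a homomorphism `Q → P`. -/
def IsPiecewiseLinear {F G : MonoidalSpace.{u}} (h : ExtCone F → ExtCone G) : Prop :=
  ∀ (P : Type u) [CommMonoid P] (j : Hom (Spec P) F), IsFSMonoid P → Subsingleton Pˣ →
    j.IsOpenImmersion →
    ∃ (Q : Type u) (_ : CommMonoid Q) (j' : Hom (Spec Q) G) (θ : Q →* P),
      IsFSMonoid Q ∧ Subsingleton Qˣ ∧ j'.IsOpenImmersion ∧
        ∀ a : P →* RBar, h (cone j a) = cone j' (a.comp θ)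

end ExtCone

/-! ## Logarithmic schemes -/

/-- The structure sheaf of a scheme as a sheaf of multiplicative monoids. -/
abbrev structureSheaf (X : Scheme.{u}) : MonoidSheaf X where
  stalk x := X.presheaf.stalk x
  IsSectionAt x s := ∃ (U : X.Opens) (_ : x ∈ U) (a : Γ(X, U)),
    ∀ y (hy : y ∈ U), s y = X.presheaf.germ U y hy a
  eventually_isSectionAt := by
    rintro x s ⟨U, hx, a, h⟩
    filter_upwards [U.isOpen.mem_nhds hx] with y hy
    exact ⟨U, hy, a, h⟩
  congr := by
    rintro x s t e ⟨U, hx, a, h⟩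
    obtain ⟨V, hV, hVo, hxV⟩ := eventually_nhds_iff.mp e
    refine ⟨U ⊓ ⟨V, hVo⟩, ⟨hx, hxV⟩, X.presheaf.map (homOfLE inf_le_left).op a, ?_⟩
    intro y hy
    rw [← hV y hy.2, h y hy.1]
    exact (X.presheaf.germ_res_apply (homOfLE inf_le_left) y hy a).symm
  exists_section := by
    intro x m
    obtain ⟨U, hx, a, rfl⟩ := X.presheaf.exists_germ_eq m
    classical
    refine ⟨fun y => if hy : y ∈ U then X.presheaf.germ U y hy a else 1, ⟨U, hx, a, ?_⟩, ?_⟩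
    · intro y hy
      simp [hy]
    · simp [hx]
  eventually_eq := by
    rintro x s t ⟨U, hx, a, h⟩ ⟨V, hx', b, h'⟩ e
    rw [h x hx, h' x hx'] at e
    obtain ⟨W, hW, iU, iV, hab⟩ := X.presheaf.germ_eq x hx hx' a b e
    filter_upwards [W.isOpen.mem_nhds hW] with y hy
    rw [h y (iU.le hy), h' y (iV.le hy), ← X.presheaf.germ_res_apply iU y hy a,
      ← X.presheaf.germ_res_apply iV y hy b, hab]
  isSectionAt_one x := ⟨⊤, trivial, 1, fun y hy => (map_one _).symm⟩
  isSectionAt_mul := by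
    rintro x s t ⟨U, hx, a, h⟩ ⟨V, hx', b, h'⟩
    refine ⟨U ⊓ V, ⟨hx, hx'⟩, X.presheaf.map (homOfLE inf_le_left).op a *
      X.presheaf.map (homOfLE inf_le_right).op b, ?_⟩
    intro y hy
    rw [map_mul, Pi.mul_apply, h y hy.1, h' y hy.2]
    congr 1
    · exact (X.presheaf.germ_res_apply (homOfLE inf_le_left) y hy a).symm
    · exact (X.presheaf.germ_res_apply (homOfLE inf_le_right) y hy b).symm

/-- A (Zariski) logarithmic structure on a scheme: a sheaf of monoids `M` with a morphism
`α : M → O_X` of sheaves of monoids inducing an isomorphism `α⁻¹(O_X^*) ≃ O_X^*`. -/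
structure LogStructure (X : Scheme.{u}) where
  M : MonoidSheaf X
  α : ∀ x, M.stalk x →* X.presheaf.stalk x
  α_section : ∀ (x : X) (s : ∀ y, M.stalk y), M.IsSectionAt x s →
    (structureSheaf X).IsSectionAt x fun y => α y (s y)
  existsUnique_unit : ∀ (x : X) (a : (X.presheaf.stalk x)ˣ),
    ∃! m : M.stalk x, α x m = (a : X.presheaf.stalk x)

namespace LogStructure

variable {X : Scheme.{u}} (L : LogStructure X)

lemma isUnit_of_isUnit_α {x : X} {m : L.M.stalk x} (h : IsUnit (L.α x m)) : IsUnit m := by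
  obtain ⟨a, ha⟩ := h
  obtain ⟨m', hm', -⟩ := L.existsUnique_unit x a⁻¹
  refine IsUnit.of_mul_eq_one m' ?_
  refine (L.existsUnique_unit x 1).unique ?_ (by simp)
  rw [map_mul, hm', ← ha]
  simp

/-- The inclusion `O_{X,x}^* → M_x` inverse to `α`. -/
def unit (x : X) : (X.presheaf.stalk x)ˣ →* L.M.stalk x where
  toFun a := (L.existsUnique_unit x a).choose
  map_one' := (L.existsUnique_unit x 1).unique (L.existsUnique_unit x 1).choose_spec.1 (by simp)
  map_mul' a b := by
    refine (L.existsUnique_unit x (a * b)).unique (L.existsUnique_unit x (a * b)).choose_spec.1 ?_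
    have ha := (L.existsUnique_unit x a).choose_spec.1
    have hb := (L.existsUnique_unit x b).choose_spec.1
    simp only at ha hb
    rw [map_mul, ha, hb, Units.val_mul]

/-- A chart `β : P_U → M_U`: the logarithmic structure on `U` associated to `α ∘ β` is `M_U`. That
is, on the stalks at all `x ∈ U` the canonical homomorphism `P × O_{X,x}^* → M_x` identifies `M_x`
with the pushout of `P ← (α ∘ β)⁻¹(O_{X,x}^*) → O_{X,x}^*`, the quotient of `P × O_{X,x}^*` by the
congruence generated by `(p, 1) ∼ (1, α(β(p)))` for `p ∈ (α ∘ β)⁻¹(O_{X,x}^*)`. -/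
structure IsChart (U : X.Opens) (P : Type u) [CommMonoid P] (β : ∀ x, P →* L.M.stalk x) :
    Prop where
  isSectionAt : ∀ x ∈ U, ∀ p, L.M.IsSectionAt x fun y => β y p
  surjective : ∀ x ∈ U, Function.Surjective ((β x).coprod (L.unit x))
  ker_eq : ∀ x ∈ U, Con.ker ((β x).coprod (L.unit x)) =
    conGen fun a b => ∃ (p : P) (c : (X.presheaf.stalk x)ˣ),
      L.α x (β x p) = c ∧ a = (p, 1) ∧ b = (1, c)

/-- A logarithmic structure is fine and saturated if there are charts by fine and saturated monoids
on the members of an open covering. -/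
def IsFS : Prop := ∀ x : X, ∃ (U : X.Opens) (_ : x ∈ U) (P : Type u) (_ : CommMonoid P)
  (β : ∀ x, P →* L.M.stalk x), IsFSMonoid P ∧ L.IsChart U P β

end LogStructure

/-- A fine and saturated Zariski logarithmic scheme of finite type over the field `k`. -/
structure FSLogScheme (k : Type u) [Field k] where
  scheme : Scheme.{u}
  toSpec : scheme ⟶ AlgebraicGeometry.Spec (CommRingCat.of k)
  locallyOfFiniteType : LocallyOfFiniteType toSpec
  quasiCompact : QuasiCompact toSpec
  log : LogStructure scheme
  fs : log.IsFS

namespace FSLogScheme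

variable {k : Type u} [Field k]

instance : CoeSort (FSLogScheme k) (Type u) := ⟨fun X => X.scheme⟩

/-- The sharp monoidal space `(X, O_X/O_X^*)`. -/
abbrev barO (X : FSLogScheme k) : MonoidalSpace.{u} := ⟨X.scheme, (structureSheaf X.scheme).bar⟩

/-- The sharp monoidal space `(X, M_X/M_X^*)`. -/
abbrev barM (X : FSLogScheme k) : MonoidalSpace.{u} := ⟨X.scheme, X.log.M.bar⟩

/-- The morphism `(X, O_X/O_X^*) → (X, M_X/M_X^*)` induced by `M_X → O_X`. -/
def barOToBarM (X : FSLogScheme k) : Hom X.barO X.barM where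
  toFun := id
  continuous_toFun := continuous_id
  stalkMap x := barMap (X.log.α x)
  isLocalHom_stalkMap x := isLocalHom_barMap _ ⟨fun _ h => X.log.isUnit_of_isUnit_α h⟩
  map_section := by
    rintro x s ⟨t, ht, h⟩
    refine ⟨_, X.log.α_section x t ht, ?_⟩
    filter_upwards [h] with y hy
    exact congrArg (barMap (X.log.α y)) hy

/-- A morphism of logarithmic schemes over `k`: a morphism `f` of `k`-schemes together with a
morphism `f⁻¹ M_Y → M_X` of sheaves of monoids compatible with `f⁻¹ O_Y → O_X`; the latter is the
same as a morphism `f^* M_Y → M_X` from the associated logarithmic structure. -/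
structure Mor (X Y : FSLogScheme k) where
  hom : X.scheme ⟶ Y.scheme
  hom_toSpec : hom ≫ Y.toSpec = X.toSpec
  flat : ∀ x : X.scheme, Y.log.M.stalk (hom x) →* X.log.M.stalk x
  flat_section : ∀ (x : X.scheme) (s : ∀ y, Y.log.M.stalk y), Y.log.M.IsSectionAt (hom x) s →
    X.log.M.IsSectionAt x fun z => flat z (s (hom z))
  α_flat : ∀ (x : X.scheme) (m : Y.log.M.stalk (hom x)),
    X.log.α x (flat x m) = (hom.stalkMap x).hom (Y.log.α (hom x) m)

namespace Mor

/-- The identity morphism. -/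
def id (X : FSLogScheme k) : Mor X X where
  hom := 𝟙 X.scheme
  hom_toSpec := Category.id_comp _
  flat x := MonoidHom.id (X.log.M.stalk x)
  flat_section _ _ h := h
  α_flat x m := by
    rw [Scheme.Hom.stalkMap_id]
    rfl

/-- The composition `g ∘ f`. -/
def comp {X Y Z : FSLogScheme k} (g : Mor Y Z) (f : Mor X Y) : Mor X Z where
  hom := f.hom ≫ g.hom
  hom_toSpec := by rw [Category.assoc, g.hom_toSpec, f.hom_toSpec]
  flat x := (f.flat x).comp (g.flat (f.hom x))
  flat_section x s h := f.flat_section x _ (g.flat_section (f.hom x) s h)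
  α_flat x m := by
    rw [Scheme.Hom.stalkMap_comp]
    exact (f.α_flat x _).trans (congrArg (f.hom.stalkMap x).hom (g.α_flat (f.hom x) m))

/-- The morphism `(X, O_X/O_X^*) → (Y, O_Y/O_Y^*)` induced by a morphism. -/
def barO {X Y : FSLogScheme k} (f : Mor X Y) : Hom X.barO Y.barO where
  toFun := f.hom
  continuous_toFun := f.hom.continuous
  stalkMap x := barMap (f.hom.stalkMap x).hom.toMonoidHom
  isLocalHom_stalkMap x := isLocalHom_barMap _
    ⟨fun a h => isUnit_of_map_unit (f.hom.stalkMap x).hom a h⟩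
  map_section := by
    rintro x s ⟨t, ⟨U, hx, a, h'⟩, h⟩
    refine ⟨fun z => (f.hom.stalkMap z).hom (t (f.hom z)),
      ⟨f.hom ⁻¹ᵁ U, hx, f.hom.app U a, ?_⟩, ?_⟩
    · intro y hy
      refine (congrArg (f.hom.stalkMap y).hom (h' (f.hom y) hy)).trans ?_
      exact Scheme.Hom.germ_stalkMap_apply f.hom U y hy a
    · filter_upwards [f.hom.continuous.continuousAt.eventually h] with z hz
      exact congrArg (barMap (f.hom.stalkMap z).hom.toMonoidHom) hz

/-- The morphism `(X, M_X/M_X^*) → (Y, M_Y/M_Y^*)` induced by a morphism. -/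
def barM {X Y : FSLogScheme k} (f : Mor X Y) : Hom X.barM Y.barM where
  toFun := f.hom
  continuous_toFun := f.hom.continuous
  stalkMap x := barMap (f.flat x)
  isLocalHom_stalkMap x := isLocalHom_barMap _ ⟨fun a h => by
    refine Y.log.isUnit_of_isUnit_α (isUnit_of_map_unit (f.hom.stalkMap x).hom _ ?_)
    rw [← f.α_flat]
    exact h.map (X.log.α x)⟩
  map_section := by
    rintro x s ⟨t, ht, h⟩
    refine ⟨_, f.flat_section x t ht, ?_⟩
    filter_upwards [f.hom.continuous.continuousAt.eventually h] with z hz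
    exact congrArg (barMap (f.flat z)) hz

end Mor

/-- A characteristic morphism of `X`: a strict morphism `(X, M_X/M_X^*) → F_X` into a fine and
saturated Kato fan (the Kato fan associated to `X`) through which every strict morphism into a fine
and saturated Kato fan factors by a unique strict morphism from `F_X`. -/
structure CharacteristicMorphism (X : FSLogScheme k) where
  fan : MonoidalSpace.{u}
  isFSKatoFan : IsFSKatoFan fan
  toFan : Hom X.barM fan
  isStrict : toFan.IsStrict
  universal : ∀ (F : MonoidalSpace.{u}) (ψ : Hom X.barM F), IsFSKatoFan F → ψ.IsStrict →
    ∃! g : Hom fan F, g.IsStrict ∧ g.comp toFan = ψ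

/-- The composition `φ_X : (X, O_X/O_X^*) → (X, M_X/M_X^*) → F_X`. -/
def CharacteristicMorphism.φ {X : FSLogScheme k} (C : CharacteristicMorphism X) :
    Hom X.barO C.fan := C.toFan.comp X.barOToBarM

end FSLogScheme

/-! ## Thuillier's analytification -/

/-- The points of `X^ℶ`. On an affine open `Spec A` they are the multiplicative seminorms on `A`
that are bounded by `1`; such a seminorm is the same as its reduction `{|f| < 1}`, a prime ideal
`p` of `A`, together with its (unique) extension to `A_p`. So a point of `X^ℶ` is a point `p` of `X`
with a multiplicative seminorm on `O_{X,p}` which is bounded by `1` and `< 1` exactly on the maximal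
ideal. (Every element of `k^*` then has seminorm `1`, if `X` is a scheme over a field `k`.) -/
@[ext] structure Beth (X : Scheme.{u}) where
  /-- the reduction map `r : X^ℶ → X` -/
  red : X
  seminorm : MulRingSeminorm (X.presheaf.stalk red)
  le_one : ∀ a, seminorm a ≤ 1
  lt_one_iff : ∀ a, seminorm a < 1 ↔ ¬ IsUnit a

namespace Beth

variable {X Y : Scheme.{u}}

/-- The kernel of the seminorm, a prime ideal of `O_{X,r(x)}`. -/
def ker (x : Beth X) : PrimeSpectrum (X.presheaf.stalk x.red) where
  asIdeal :=
    { carrier := {a | x.seminorm a = 0}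
      add_mem' := fun {a b} ha hb => le_antisymm
        ((map_add_le_add x.seminorm a b).trans_eq
          (by rw [show x.seminorm a = 0 from ha, show x.seminorm b = 0 from hb, add_zero]))
        (apply_nonneg x.seminorm _)
      zero_mem' := map_zero x.seminorm
      smul_mem' := fun a b hb => by
        show x.seminorm (a * b) = 0
        rw [map_mul, show x.seminorm b = 0 from hb, mul_zero] }
  isPrime :=
    { ne_top' := fun h => by
        have h1 : x.seminorm 1 = 0 := (Ideal.eq_top_iff_one _).mp h
        rw [map_one] at h1
        exact one_ne_zero h1
      mem_or_mem' := fun {a b} h => by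
        have h1 : x.seminorm (a * b) = 0 := h
        rw [map_mul] at h1
        exact mul_eq_zero.mp h1 }

/-- The structure map `ρ : X^ℶ → X`, locally `x ↦ ker |.|_x`. -/
def str (x : Beth X) : X := X.fromSpecStalk x.red x.ker

/-- The set `r⁻¹(U)`, which is `U^ℶ`. -/
abbrev Dom (U : X.Opens) : Type u := {x : Beth X // x.red ∈ U}

/-- The value `|f|_x` of a function `f ∈ O_X(U)` at a point `x ∈ U^ℶ`. -/
def eval (U : X.Opens) (x : Dom U) (f : Γ(X, U)) : ℝ :=
  x.1.seminorm (X.presheaf.germ U x.1.red x.2 f)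

/-- The topology on `U^ℶ` for `U` open and affine: the coarsest one for which the functions
`x ↦ |f|_x`, `f ∈ O_X(U)`, are continuous. -/
abbrev domTopology (U : X.Opens) : TopologicalSpace (Dom U) :=
  TopologicalSpace.induced (eval U) Pi.topologicalSpace

/-- The topology on `X^ℶ`, glued from those of the `U^ℶ`, `U` open and affine: a set is open if and
only if so are its intersections with all `U^ℶ`. -/
instance (X : Scheme.{u}) : TopologicalSpace (Beth X) :=
  ⨆ (U : X.Opens) (_ : IsAffineOpen U), (domTopology U).coinduced Subtype.val

/-- The map `f^ℶ : X^ℶ → Y^ℶ`, locally the pullback of seminorms. -/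
def map (f : X ⟶ Y) (x : Beth X) : Beth Y where
  red := f x.red
  seminorm :=
    { toFun := fun a => x.seminorm ((f.stalkMap x.red).hom a)
      map_zero' := by simp
      add_le' := fun a b => by rw [map_add]; exact map_add_le_add _ _ _
      neg' := fun a => by rw [map_neg, map_neg_eq_map]
      map_one' := by simp
      map_mul' := fun a b => by rw [map_mul, map_mul] }
  le_one a := x.le_one _
  lt_one_iff a := (x.lt_one_iff _).trans
    (not_congr ⟨fun h => isUnit_of_map_unit (f.stalkMap x.red).hom a h, fun h => h.map _⟩)

variable {K : Type u} [Field K] (v : Valuation K ℝ≥0)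

/-- The point of `X^ℶ` represented by a morphism `Spec R → X`, where `R` is the valuation ring of
a field `K` with a non-Archimedean absolute value `v`. -/
def ofMor (g : AlgebraicGeometry.Spec (CommRingCat.of v.valuationSubring) ⟶ X) : Beth X where
  red := g (IsLocalRing.closedPoint v.valuationSubring)
  seminorm :=
    { toFun := fun a => (v ((Scheme.stalkClosedPointTo g).hom a : v.valuationSubring) : ℝ)
      map_zero' := by simp
      add_le' := fun a b => by
        rw [map_add]
        exact_mod_cast (v.map_add _ _).trans (max_le_add_of_nonneg zero_le zero_le)
      neg' := fun a => by
        rw [map_neg]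
        exact congrArg NNReal.toReal (v.map_neg _)
      map_one' := by simp
      map_mul' := fun a b => by
        rw [map_mul]
        exact congrArg NNReal.toReal (v.map_mul _ _) }
  le_one a := by
    have h := ((Scheme.stalkClosedPointTo g).hom a : v.valuationSubring).2
    exact_mod_cast (v.mem_valuationSubring_iff _).mp h
  lt_one_iff a := by
    have h1 : IsUnit ((Scheme.stalkClosedPointTo g).hom a) ↔ IsUnit a :=
      ⟨fun h => isUnit_of_map_unit (Scheme.stalkClosedPointTo g).hom a h, fun h => h.map _⟩
    have h2 := (Valuation.valuationSubring.integers v).isUnit_iff_valuation_eq_one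
      (x := (Scheme.stalkClosedPointTo g).hom a)
    have h3 := (v.mem_valuationSubring_iff _).mp
      ((Scheme.stalkClosedPointTo g).hom a : v.valuationSubring).2
    have h4 : (v ((Scheme.stalkClosedPointTo g).hom a : v.valuationSubring) : ℝ) < 1 ↔
        v ((Scheme.stalkClosedPointTo g).hom a : v.valuationSubring) < 1 := by
      exact_mod_cast Iff.rfl
    exact h4.trans ((lt_iff_le_and_ne.trans (and_iff_right h3)).trans
      (not_congr (h2.symm.trans h1)))

end Beth

/-! ## The tropicalization map -/

/-- `-log t ∈ [0,∞]` for `t ∈ [0,1]`, with `-log 0 = ∞`. -/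
def negLog (t : ℝ≥0) : ℝ≥0∞ := if t = 0 then ∞ else ENNReal.ofReal (-Real.log t)

/-- The homomorphism `val = -log |.| : R → [0,∞]` on the valuation ring `R` of `(K, v)`. -/
def val {K : Type u} [Field K] (v : Valuation K ℝ≥0) : v.valuationSubring →* RBar where
  toFun a := Multiplicative.ofAdd (negLog (v a))
  map_one' := by simp [negLog]
  map_mul' a b := by
    have ha : v a ≤ 1 := (v.mem_valuationSubring_iff _).mp a.2
    have hb : v b ≤ 1 := (v.mem_valuationSubring_iff _).mp b.2
    rw [← ofAdd_add]
    congr 1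
    by_cases h : v (a : K) = 0
    · simp [negLog, h]
    by_cases h' : v (b : K) = 0
    · simp [negLog, h']
    have la : 0 ≤ -Real.log (v a) := by
      have := Real.log_nonpos (v a).2 (by exact_mod_cast ha)
      linarith!
    have lb : 0 ≤ -Real.log (v b) := by
      have := Real.log_nonpos (v b).2 (by exact_mod_cast hb)
      linarith!
    simp only [negLog, MulMemClass.coe_mul, map_mul, mul_eq_zero, h, h', or_self, if_false]
    rw [NNReal.coe_mul, Real.log_mul (by simpa using h) (by simpa using h'), neg_add,
      ENNReal.ofReal_add la lb]

namespace FSLogScheme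

variable {k : Type u} [Field k]

/-- For `x ∈ X^ℶ` represented by `g : Spec R → X`, the homomorphism
`(O_X/O_X^*)_{r(x)} → R/R^* → [0,∞]` on the stalk at the closed point given by `g` and `val`. -/
def valBar (X : FSLogScheme k) {K : Type u} [Field K] (v : Valuation K ℝ≥0)
    (g : AlgebraicGeometry.Spec (CommRingCat.of v.valuationSubring) ⟶ X.scheme) :
    X.barO.stalk (Beth.ofMor v g).red →* RBar :=
  (barLift (val v)).comp (barMap (Scheme.stalkClosedPointTo g).hom.toMonoidHom)

/-- The point `u ∈ F([0,∞])` is the composition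
`Spec [0,∞] → Spec R → (X, O_X/O_X^*) → F` of `val^#`, the morphism given by `g`, and `φ`. This
means that `u` sends the closed point `(0,∞]` to the image of the closed point of `Spec R`, and
that its homomorphism of stalks at the closed point is
`O_{F,φ(r(x))} → (O_X/O_X^*)_{r(x)} → R/R^* → [0,∞]`. The latter is tested on families `s` in the
stalks of `F`, so as to identify the stalks of `F` at the (equal) points `u((0,∞])`, `φ(r(x))`. -/
def IsComposition (X : FSLogScheme k) {F : MonoidalSpace.{u}} (φ : Hom X.barO F)
    {K : Type u} [Field K] (v : Valuation K ℝ≥0)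
    (g : AlgebraicGeometry.Spec (CommRingCat.of v.valuationSubring) ⟶ X.scheme)
    (x : ExtCone F) : Prop :=
  x.red = φ (Beth.ofMor v g).red ∧
  ∀ s : ∀ y, F.stalk y, Hom.stalkMap x closedPt (s x.red) =
    toClosedStalk (X.valBar v g (φ.stalkMap _ (s (φ (Beth.ofMor v g).red))))

/-- `t` is the tropicalization map `X^ℶ → F_X([0,∞])`: it sends the point represented by any
morphism `g : Spec R → X` to the composition `Spec [0,∞] → Spec R → (X, O_X/O_X^*) → F_X`. -/
def IsTrop {X : FSLogScheme k} (C : CharacteristicMorphism X)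
    (t : Beth X.scheme → ExtCone C.fan) : Prop :=
  ∀ (K : Type u) [Field K] (v : Valuation K ℝ≥0)
    (g : AlgebraicGeometry.Spec (CommRingCat.of v.valuationSubring) ⟶ X.scheme),
    X.IsComposition C.φ v g (t (Beth.ofMor v g))

end FSLogScheme

end

end LogTrop

open LogTrop LogTrop.FSLogScheme

/-!
The argument has three parts.

**Fans.** The stalk of a fine and saturated Kato fan at `q` is a fine and saturated sharp monoid
`N`, and the smallest neighbourhood of `q`, the set of its generizations, is `Spec N`
(`IsFSKatoFan.nonempty_chartAt`). A morphism from `Spec P` to a fan is determined by the image of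
the closed point and the homomorphism of stalks there, and any local homomorphism of stalks occurs
(`ChartAt.hom_ext`, `Hom.exists_of_localHom`). More generally, since `N` is finitely generated, two
morphisms from any monoidal space to a fan which agree at a point agree in a neighbourhood of it
(`ChartAt.eventually_agreeAt`).

**Functoriality.** The characteristic morphism `φ : Z → F` is initial among *strict* morphisms only,
whereas a morphism of logarithmic schemes gives a morphism `ψ : Z → G` which need not be strict. Let
`E → F` be the étalé space of the sheaf of morphisms from open subsets of `F` to `G`
(`GermSpace`). With the inverse image of the structure sheaf of `F` it is locally isomorphic to `F`,
and evaluation of germs is a morphism `E → G`. The germs `ψ ∘ φ⁻¹` at the points `φ(x)` define a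
*strict* morphism `Z → E` (`exists_lift_germSpace`); as `Z` is compact, it factors through a compact
open subset of `E`, which is a fine and saturated Kato fan. The universal property of `φ` gives
`F → E`, and the composition `F → E → G` is the required morphism. It is unique because the
generizations of the points of `φ(Z)` form an open subfan through which `φ` factors, which has to be
`F`, again by the universal property (`existsUnique_hom_of_universal`).

**Tropicalization.** A point `x` of the analytification gives the local homomorphism `-log |.|_x` on
the local ring at `r(x)`, and thus a unique morphism `Spec [0,∞] → F`
(`existsUnique_isTropAt`). Since a multiplicative seminorm bounded by `1` is non-Archimedean, every
point is represented by a valuation ring (`Beth.exists_ofMor_eq`), and so these morphisms form the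
only tropicalization map. For continuity one uses that the reduction map is anticontinuous, that is,
`D(f)` has the closed preimage `{|f| = 1}`. So an affine `U^ℶ` is covered by finitely many closed
subsets, on each of which tropicalization takes values in one extended cone `Hom(N,[0,∞])` and has
coordinates `-log |b|_x`, for functions `b` on `U` that represent generators of `N`
(`exists_isClosed_continuousOn`).
-/

namespace LogTrop

noncomputable section

open MonoidalSpace PrimeIdeal

/-! ### Fine and saturated monoids -/

/-- Fine and saturated monoids without reference to the Grothendieck group: saturation says that
divisibility of `n`-th powers implies divisibility. -/
lemma isFSMonoid_iff (P : Type u) [CommMonoid P] :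
    IsFSMonoid P ↔ Monoid.FG P ∧ IsCancelMul P ∧
      ∀ (a b : P) (n : ℕ), 0 < n → b ^ n ∣ a ^ n → b ∣ a := by
  have key : ∀ (g : Algebra.GrothendieckGroup P), ∃ a b : P,
      g * Algebra.GrothendieckGroup.of b = Algebra.GrothendieckGroup.of a := by
    intro g
    induction g using Localization.induction_on with
    | H y =>
      refine ⟨y.1, y.2, ?_⟩
      rw [Localization.mk_eq_monoidOf_mk'_apply]
      exact (Localization.monoidOf ⊤).mk'_spec y.1 y.2
  constructor
  · rintro ⟨h1, h2, h3⟩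
    have hc : ∀ a b c : P, a * b = a * c → b = c := fun a b c h =>
      h2 (mul_left_cancel (a := Algebra.GrothendieckGroup.of a) (by rw [← map_mul, h, map_mul]))
    refine ⟨h1, { mul_left_cancel := fun a b c => hc a b c
                  mul_right_cancel := fun a b c h => hc a b c (by simpa only [mul_comm] using h) },
      fun a b n hn ⟨c, h⟩ => ?_⟩
    obtain ⟨d, hd⟩ := h3 (Algebra.GrothendieckGroup.of a / Algebra.GrothendieckGroup.of b) n hn
      ⟨c, by rw [div_pow, eq_div_iff_mul_eq', ← map_pow, ← map_pow, ← map_mul, h, mul_comm]⟩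
    refine ⟨d, h2 ?_⟩
    rw [map_mul, hd, mul_div_cancel]
  · rintro ⟨h1, h2, h3⟩
    refine ⟨h1, Algebra.GrothendieckGroup.of_injective, fun g n hn ⟨c, hc⟩ => ?_⟩
    obtain ⟨a, b, h⟩ := key g
    obtain ⟨d, rfl⟩ := h3 a b n hn ⟨c, Algebra.GrothendieckGroup.of_injective (by
      rw [map_mul, map_pow, map_pow, ← h, hc, mul_pow, mul_comm])⟩
    refine ⟨d, mul_right_cancel (b := Algebra.GrothendieckGroup.of b) ?_⟩
    rw [h, ← map_mul, mul_comm]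

namespace PrimeIdeal

variable {P : Type u} [CommMonoid P]

/-! ### Spectra of monoids -/

/-- The closed point of `Spec P`: the ideal of nonunits. -/
def closedPoint (P : Type u) [CommMonoid P] : PrimeIdeal P where
  carrier := {a | ¬ IsUnit a}
  mul_mem a b hb h := hb (isUnit_of_mul_isUnit_right h)
  one_notMem h := h isUnit_one
  mem_or_mem {a b} h := by
    by_contra! hc
    exact h ((not_not.mp hc.1).mul (not_not.mp hc.2))

lemma mem_face_closedPoint {a : P} : a ∈ (closedPoint P).face ↔ IsUnit a := not_not

lemma mem_face_of_isUnit (p : PrimeIdeal P) {a : P} (ha : IsUnit a) : a ∈ p.face := by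
  obtain ⟨b, hb⟩ := ha.exists_left_inv
  exact mem_face_of_mul (a := b) (hb ▸ p.face.one_mem)

lemma specializes_closedPoint (p : PrimeIdeal P) : p ⤳ closedPoint P := by
  rw [Specializes, nhds_generateFrom (a := closedPoint P)]
  refine le_iInf₂ fun s hs => ?_
  obtain ⟨h, a, rfl⟩ := hs
  exact Filter.le_principal_iff.mpr ((isOpen_basicOpen a).mem_nhds
    (p.mem_face_of_isUnit (mem_face_closedPoint.mp h)))

/-- The only neighbourhood of the closed point is the whole spectrum. -/
lemma eventually_closedPoint {q : PrimeIdeal P → Prop} :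
    (∀ᶠ p in 𝓝 (closedPoint P), q p) ↔ ∀ p, q p :=
  ⟨fun h p => (h.filter_mono (specializes_closedPoint p)).self_of_nhds, .of_forall⟩

lemma toStalk_eq_of_closedPoint (p : PrimeIdeal P) {a b : P}
    (h : (closedPoint P).toStalk a = (closedPoint P).toStalk b) : p.toStalk a = p.toStalk b := by
  obtain ⟨c, hc, d, hd, e⟩ := toStalk_eq_iff.mp h
  exact toStalk_eq_iff.mpr ⟨c, p.mem_face_of_isUnit (mem_face_closedPoint.mp hc), d,
    p.mem_face_of_isUnit (mem_face_closedPoint.mp hd), e⟩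

/-- A sharp monoid is the stalk of its spectrum at the closed point. -/
lemma toStalk_closedPoint_bijective [Subsingleton Pˣ] :
    Function.Bijective (closedPoint P).toStalk := by
  refine ⟨fun a b h => ?_, toStalk_surjective _⟩
  obtain ⟨c, hc, d, hd, e⟩ := toStalk_eq_iff.mp h
  have h1 : ∀ c : P, IsUnit c → c = 1 := by
    rintro _ ⟨c, rfl⟩
    simp [Subsingleton.elim c 1]
  simpa [h1 c (mem_face_closedPoint.mp hc), h1 d (mem_face_closedPoint.mp hd)] using e

lemma isFSMonoid_stalk (hP : IsFSMonoid P) (p : PrimeIdeal P) : IsFSMonoid p.Stalk := by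
  rw [isFSMonoid_iff] at hP ⊢
  obtain ⟨h1, h2, h3⟩ := hP
  have key : ∀ a b c d : P, c ∈ p.face → d ∈ p.face → c * a = d * b →
      p.toStalk a = p.toStalk b := fun a b c d hc hd h => toStalk_eq_iff.mpr ⟨c, hc, d, hd, h⟩
  refine ⟨?_, ?_, ?_⟩
  · exact Monoid.fg_of_surjective p.toStalk p.toStalk_surjective
  · have hc : ∀ a b c : p.Stalk, a * b = a * c → b = c := by
      intro a b c h
      obtain ⟨a, rfl⟩ := p.toStalk_surjective a
      obtain ⟨b, rfl⟩ := p.toStalk_surjective b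
      obtain ⟨c, rfl⟩ := p.toStalk_surjective c
      rw [← map_mul, ← map_mul] at h
      obtain ⟨s, hs, t, ht, e⟩ := toStalk_eq_iff.mp h
      refine key b c s t hs ht (mul_left_cancel (a := a) ?_)
      rw [mul_left_comm, e, mul_left_comm]
    exact { mul_left_cancel := fun a b c => hc a b c
            mul_right_cancel := fun a b c h =>
              hc a b c (by simpa only [mul_comm] using h) }
  · intro a b n hn h
    obtain ⟨a, rfl⟩ := p.toStalk_surjective a
    obtain ⟨b, rfl⟩ := p.toStalk_surjective b
    obtain ⟨c, h⟩ := h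
    obtain ⟨c, rfl⟩ := p.toStalk_surjective c
    rw [← map_pow, ← map_pow, ← map_mul] at h
    obtain ⟨s, hs, t, ht, e⟩ := toStalk_eq_iff.mp h
    obtain ⟨m, rfl⟩ := Nat.exists_eq_succ_of_ne_zero hn.ne'
    have h4 : b ^ (m + 1) ∣ (s * a) ^ (m + 1) := by
      refine ⟨s ^ m * t * c, ?_⟩
      rw [mul_pow, pow_succ, mul_assoc (s ^ m), e]
      simp only [mul_assoc, mul_left_comm]
    obtain ⟨d, hd⟩ := h3 _ _ _ hn h4
    exact ⟨p.toStalk d, by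
      rw [← map_mul]; exact key _ _ s 1 hs p.face.one_mem (by rw [hd, one_mul])⟩

/-- For a finitely generated monoid, the generizations of `p` form a basic open subset, defined by
the product of the generators not contained in `p`. -/
lemma isOpen_setOf_subset (hP : Monoid.FG P) (p : PrimeIdeal P) :
    IsOpen {q : PrimeIdeal P | q.carrier ⊆ p.carrier} := by
  classical
  obtain ⟨S, hS⟩ := hP.fg_top
  have : {q : PrimeIdeal P | q.carrier ⊆ p.carrier} =
      ⋂ a ∈ S.filter (· ∈ p.face), basicOpen a := by
    ext q
    simp only [Set.mem_ofPred_eq, Set.mem_iInter, Finset.mem_filter]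
    refine ⟨fun h a ha haq => ha.2 (h haq), fun h a haq => ?_⟩
    by_contra hap
    have : ∀ a (_ : a ∈ Submonoid.closure (S : Set P)), a ∈ p.face → a ∈ q.face := by
      intro a ha
      induction ha using Submonoid.closure_induction with
      | mem a ha => exact fun hp => h a ⟨ha, hp⟩
      | one => exact fun _ => q.face.one_mem
      | mul a b _ _ iha ihb =>
        exact fun hp => q.face.mul_mem (iha (mem_face_of_mul (mul_comm a b ▸ hp)))
          (ihb (mem_face_of_mul hp))
    exact this a (hS ▸ Submonoid.mem_top a) hap haq
  rw [this]
  exact isOpen_biInter_finset fun a _ => isOpen_basicOpen a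

/-- `Spec P_p/P_p^* → Spec P` is an open immersion with image the smallest neighbourhood of `p`. -/
lemma isOpenImmersion_specMap_toStalk (hP : Monoid.FG P) (p : PrimeIdeal P) :
    (Spec.map p.toStalk).IsOpenImmersion := by
  have hinj : Function.Injective (comap p.toStalk) := fun q q' h =>
    PrimeIdeal.ext (p.toStalk_surjective.preimage_injective (congrArg PrimeIdeal.carrier h))
  have hle : ∀ q : PrimeIdeal p.Stalk, (comap p.toStalk q).carrier ⊆ p.carrier := by
    intro q a ha
    by_contra hap
    exact q.mem_face_of_isUnit (isUnit_toStalk.mpr hap) ha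
  refine ⟨⟨⟨⟨?_⟩, hinj⟩, ?_⟩, ?_⟩
  · refine le_antisymm (continuous_comap p.toStalk).le_induced ?_
    refine le_generateFrom ?_
    rintro _ ⟨m, rfl⟩
    obtain ⟨a, rfl⟩ := p.toStalk_surjective m
    exact ⟨basicOpen a, isOpen_basicOpen a, rfl⟩
  · convert isOpen_setOf_subset hP p using 1
    refine Set.Subset.antisymm ?_ ?_
    · rintro _ ⟨q, rfl⟩
      exact hle q
    · intro q hq
      -- membership in `q ⊆ p` only depends on the image in the stalk at `p`
      have hcomp : ∀ a b, p.toStalk a = p.toStalk b → a ∈ q.carrier → b ∈ q.carrier := by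
        intro a b h ha
        obtain ⟨c, hc, d, hd, e⟩ := toStalk_eq_iff.mp h
        exact (q.mem_or_mem (e ▸ q.mul_mem c ha)).resolve_left fun h => hd (hq h)
      refine ⟨{ carrier := p.toStalk '' q.carrier, mul_mem := ?_, one_notMem := ?_,
                mem_or_mem := ?_ }, ?_⟩
      · rintro m _ ⟨b, hb, rfl⟩
        obtain ⟨a, rfl⟩ := p.toStalk_surjective m
        exact ⟨a * b, q.mul_mem a hb, map_mul _ _ _⟩
      · rintro ⟨a, ha, h⟩
        exact q.one_notMem (hcomp a 1 (h.trans (map_one _).symm) ha)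
      · rintro m m' ⟨c, hc, h⟩
        obtain ⟨a, rfl⟩ := p.toStalk_surjective m
        obtain ⟨b, rfl⟩ := p.toStalk_surjective m'
        exact (q.mem_or_mem (hcomp c (a * b) (h.trans (map_mul _ _ _).symm) hc)).imp
          (fun h => ⟨a, h, rfl⟩) (fun h => ⟨b, h, rfl⟩)
      · refine PrimeIdeal.ext (Set.ext fun a => ⟨?_, fun h => ⟨a, h, rfl⟩⟩)
        rintro ⟨c, hc, h⟩
        exact hcomp c a h hc
  · intro q
    constructor
    · intro m m' h
      obtain ⟨a, rfl⟩ := toStalk_surjective _ m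
      obtain ⟨b, rfl⟩ := toStalk_surjective _ m'
      have h' : q.toStalk (p.toStalk a) = q.toStalk (p.toStalk b) :=
        (stalkMap_toStalk p.toStalk q a).symm.trans (h.trans (stalkMap_toStalk p.toStalk q b))
      obtain ⟨c, hc, d, hd, e⟩ := toStalk_eq_iff.mp h'
      obtain ⟨c, rfl⟩ := p.toStalk_surjective c
      obtain ⟨d, rfl⟩ := p.toStalk_surjective d
      rw [← map_mul, ← map_mul] at e
      obtain ⟨s, hs, t, ht, e'⟩ := toStalk_eq_iff.mp e
      refine toStalk_eq_iff.mpr ⟨s * c, ?_, t * d, ?_, by simpa only [mul_assoc] using e'⟩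
      · exact Submonoid.mul_mem _ (fun h => hs (hle q h)) hc
      · exact Submonoid.mul_mem _ (fun h => ht (hle q h)) hd
    · intro m
      obtain ⟨n, rfl⟩ := q.toStalk_surjective m
      obtain ⟨a, rfl⟩ := p.toStalk_surjective n
      exact ⟨_, stalkMap_toStalk p.toStalk q a⟩

lemma comap_toStalk_closedPoint (p : PrimeIdeal P) :
    comap p.toStalk (closedPoint p.Stalk) = p :=
  PrimeIdeal.ext (Set.ext fun _ => not_iff_comm.mp isUnit_toStalk.symm)

end PrimeIdeal

/-! ### Morphisms of monoidal spaces -/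

namespace MonoidalSpace.Hom

variable {X : MonoidalSpace.{u}} {Y : MonoidalSpace.{v}} {Z : MonoidalSpace.{w}}

lemma isUnit_stalkMap (f : Hom X Y) {x : X} {m : Y.stalk (f x)} :
    IsUnit (f.stalkMap x m) ↔ IsUnit m :=
  ⟨(f.isLocalHom_stalkMap x).map_nonunit m, fun h => h.map _⟩

/-- Two morphisms agree at `x` if they have the same value and the same homomorphism of stalks
at `x`. The latter are compared on families in the stalks of `Y`, to avoid transport along the
equality of the values. -/
def AgreeAt (f g : Hom X Y) (x : X) : Prop :=
  f x = g x ∧ ∀ s : ∀ y, Y.stalk y, f.stalkMap x (s (f x)) = g.stalkMap x (s (g x))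

lemma ext_agreeAt {f g : Hom X Y} (h : ∀ x, AgreeAt f g x) : f = g := by
  obtain ⟨f, hf, φ, hφ, hφ'⟩ := f
  obtain ⟨g, hg, ψ, hψ, hψ'⟩ := g
  obtain rfl : f = g := funext fun x => (h x).1
  obtain rfl : φ = ψ := by
    funext x
    ext m
    obtain ⟨s, -, rfl⟩ := Y.sheaf.exists_section m
    exact (h x).2 s
  rfl

lemma AgreeAt.of_eq {f g : Hom X Y} (h : f = g) (x : X) : AgreeAt f g x :=
  h ▸ ⟨rfl, fun _ => rfl⟩

lemma AgreeAt.of_comp_right {f g : Hom Y Z} {e : Hom X Y} {x : X}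
    (he : Function.Injective (e.stalkMap x)) (h : AgreeAt (f.comp e) (g.comp e) x) :
    AgreeAt f g (e x) :=
  ⟨h.1, fun s => he (h.2 s)⟩

/-- Every germ on the source of a strict morphism is the pullback of the germ of a section. -/
lemma IsStrict.exists_family {j : Hom X Y} (hj : j.IsStrict) (c : X) (m : X.stalk c) :
    ∃ s : ∀ y, Y.stalk y, Y.sheaf.IsSectionAt (j c) s ∧ j.stalkMap c (s (j c)) = m := by
  obtain ⟨n, rfl⟩ := (hj c).2 m
  obtain ⟨s, hs, rfl⟩ := Y.sheaf.exists_section n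
  exact ⟨s, hs, rfl⟩

/-- Lifting along a strict morphism is a topological problem: a continuous lift of the underlying
map lifts to a morphism, as the homomorphisms on the stalks can be inverted. -/
lemma IsStrict.exists_lift {j : Hom Y Z} (hj : j.IsStrict) (f : Hom X Z) (f' : X → Y)
    (hf' : Continuous f') (h : ∀ x, j (f' x) = f x) :
    ∃ g : Hom X Y, g.toFun = f' ∧ j.comp g = f := by
  obtain ⟨f, hf, φ, hφ, hφ'⟩ := f
  obtain rfl : j ∘ f' = f := funext h
  let e (y : Y) := MulEquiv.ofBijective (j.stalkMap y) (hj y)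
  have he : ∀ y m, (e y).symm (j.stalkMap y m) = m := fun y m => (e y).symm_apply_apply m
  have he' : ∀ y m, j.stalkMap y ((e y).symm m) = m := fun y m => (e y).apply_symm_apply m
  refine ⟨⟨f', hf', fun x => (φ x).comp (e (f' x)).symm.toMonoidHom, fun x => ⟨fun m hm => ?_⟩,
    fun x s hs => ?_⟩, rfl, ?_⟩
  · have := ((hφ x).map_nonunit _ hm).map (j.stalkMap (f' x))
    rw [← he' (f' x) m]
    exact this
  · obtain ⟨t, ht, hts⟩ := hj.exists_family (f' x) (s (f' x))
    have h1 := Y.sheaf.eventually_eq (j.map_section _ t ht) hs hts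
    refine X.sheaf.congr ?_ (hφ' x t ht)
    filter_upwards [hf'.continuousAt.eventually h1] with z hz
    change _ = φ z ((e (f' z)).symm (s (f' z)))
    rw [← hz, he]
    rfl
  · refine ext_agreeAt fun x => ⟨rfl, fun s => ?_⟩
    exact congrArg (φ x) (he (f' x) (s (j (f' x))))

lemma IsStrict.comp {g : Hom Y Z} {f : Hom X Y} (hg : g.IsStrict) (hf : f.IsStrict) :
    (g.comp f).IsStrict := fun x => (hf x).comp (hg (f x))

lemma IsStrict.of_comp {g : Hom Y Z} {f : Hom X Y} (hg : g.IsStrict) (h : (g.comp f).IsStrict) :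
    f.IsStrict := fun x =>
  (Function.Bijective.of_comp_iff _ (hg (f x))).mp (h x)

lemma IsOpenImmersion.comp {g : Hom Y Z} {f : Hom X Y} (hg : g.IsOpenImmersion)
    (hf : f.IsOpenImmersion) : (g.comp f).IsOpenImmersion :=
  ⟨hg.1.comp hf.1, hg.2.comp hf.2⟩

lemma eventually_mem_range {j : Hom X Y} (hj : j.IsOpenImmersion) (c : X) :
    ∀ᶠ y in 𝓝 (j c), y ∈ Set.range j :=
  hj.isOpenEmbedding.isOpen_range.mem_nhds ⟨c, rfl⟩

/-! ### Morphisms from the spectrum of a monoid -/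

/-- The image of an open immersion of a spectrum is the smallest neighbourhood of the image of the
closed point. -/
lemma range_eq_setOf_specializes {P : Type v} [CommMonoid P] {j : Hom (Spec P) X}
    (hj : j.IsOpenImmersion) : Set.range j = {x | x ⤳ j (closedPoint P)} := by
  refine Set.Subset.antisymm ?_ fun x hx =>
    hx.mem_open hj.isOpenEmbedding.isOpen_range ⟨_, rfl⟩
  rintro _ ⟨p, rfl⟩
  exact (specializes_closedPoint p).map j.continuous_toFun

/-- A morphism out of `Spec P` takes germs of sections at the image of the closed point to elements
of `P`. -/
lemma exists_eq_toStalk {P : Type v} [CommMonoid P] (j : Hom (Spec P) X) {s : ∀ x, X.stalk x}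
    (hs : X.sheaf.IsSectionAt (j (closedPoint P)) s) {a : P}
    (ha : j.stalkMap (closedPoint P) (s (j (closedPoint P))) = (closedPoint P).toStalk a)
    (p : PrimeIdeal P) : j.stalkMap p (s (j p)) = p.toStalk a := by
  obtain ⟨b, hb⟩ := j.map_section (closedPoint P) s hs
  have hb' := eventually_closedPoint.mp hb
  exact (hb' p).trans (toStalk_eq_of_closedPoint p ((hb' (closedPoint P)).symm.trans ha))

/-- For a strict morphism `j` from `Spec P`, every element of `P` is the pullback of a section near
the image of the closed point. -/
lemma exists_section_of_element {P : Type v} [CommMonoid P] {j : Hom (Spec P) X}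
    (hj : j.IsStrict) (a : P) : ∃ s, X.sheaf.IsSectionAt (j (closedPoint P)) s ∧
      ∀ p, j.stalkMap p (s (j p)) = p.toStalk a := by
  obtain ⟨s, hs, h⟩ := hj.exists_family (closedPoint P) ((closedPoint P).toStalk a)
  exact ⟨s, hs, j.exists_eq_toStalk hs h⟩

/-- A local homomorphism from the stalk at a point of a chart `j` to a monoid `P` is induced by a
morphism `Spec P → Spec N → X`. -/
lemma exists_of_localHom {N : Type w} [CommMonoid N] {P : Type v} [CommMonoid P]
    {j : Hom (Spec N) X} (hj : j.IsStrict) {n : PrimeIdeal N} {q : X} (hq : j n = q)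
    (h : X.stalk q →* P) (hh : IsLocalHom h) :
    ∃ θ : N →* P, j.comp (Spec.map θ) (closedPoint P) = q ∧ ∀ s : ∀ x, X.stalk x,
        (j.comp (Spec.map θ)).stalkMap (closedPoint P) (s (j.comp (Spec.map θ) (closedPoint P))) =
          (closedPoint P).toStalk (h (s q)) := by
  subst hq
  let e := MulEquiv.ofBijective (j.stalkMap n) (hj n)
  have he : ∀ m, e (e.symm m) = m := e.apply_symm_apply
  let θ : N →* P := (h.comp e.symm.toMonoidHom).comp n.toStalk
  have hθ : comap θ (closedPoint P) = n := by
    refine PrimeIdeal.ext (Set.ext fun a => not_iff_comm.mp ?_)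
    rw [← mem_face, ← isUnit_toStalk]
    refine ⟨fun ha => (ha.map e.symm.toMonoidHom).map h, fun ha => ?_⟩
    have h1 := (hh.map_nonunit _ ha).map e
    exact (he (n.toStalk a)) ▸ h1
  refine ⟨θ, congrArg j hθ, fun s => ?_⟩
  obtain ⟨a, ha⟩ := n.toStalk_surjective (j.stalkMap n (s (j n)))
  have h1 : ∀ p, p = n → j.stalkMap p (s (j p)) = p.toStalk a := by
    rintro _ rfl
    exact ha.symm
  change PrimeIdeal.stalkMap θ _ (j.stalkMap (comap θ (closedPoint P)) (s (j _))) = _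
  rw [h1 _ hθ, PrimeIdeal.stalkMap_toStalk]
  change (closedPoint P).toStalk (h (e.symm (n.toStalk a))) = _
  rw [ha]
  exact congrArg (fun m => (closedPoint P).toStalk (h m)) (e.symm_apply_apply _)

end MonoidalSpace.Hom

/-! ### Local structure of Kato fans -/

/-- A chart at a point `q`: an open immersion of the spectrum of a sharp fine and saturated monoid
which takes the closed point to `q`. -/
structure ChartAt (F : MonoidalSpace.{u}) (q : F) where
  N : Type u
  [commMonoid : CommMonoid N]
  isFS : IsFSMonoid N
  [sharp : Subsingleton Nˣ]
  toHom : Hom (Spec N) F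
  isOpenImmersion : toHom.IsOpenImmersion
  map_closedPoint : toHom (closedPoint N) = q

attribute [instance] ChartAt.commMonoid ChartAt.sharp

instance {P : Type u} [CommMonoid P] : Subsingleton (Associates P)ˣ :=
  ⟨fun a b => by rw [Subsingleton.elim a b]⟩

lemma IsFSKatoFan.nonempty_chartAt {F : MonoidalSpace.{u}} (hF : IsFSKatoFan F) (q : F) :
    Nonempty (ChartAt F q) := by
  obtain ⟨P, _, j, hj, hq⟩ := hF.exists_affine q
  obtain ⟨Q, _, j', hQ, hj', h⟩ := hF.affine_fs P j hj
  rw [← h] at hq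
  obtain ⟨p, rfl⟩ := hq
  exact ⟨{
    N := p.Stalk
    isFS := isFSMonoid_stalk hQ p
    toHom := j'.comp (Spec.map p.toStalk)
    isOpenImmersion := hj'.comp (isOpenImmersion_specMap_toStalk hQ.fg p)
    map_closedPoint := congrArg j' (comap_toStalk_closedPoint p) }⟩

/-- A chart at `q` in a fine and saturated Kato fan. -/
def IsFSKatoFan.chartAt {F : MonoidalSpace.{u}} (hF : IsFSKatoFan F) (q : F) : ChartAt F q :=
  (hF.nonempty_chartAt q).some

namespace ChartAt

variable {F : MonoidalSpace.{u}} {q : F} (c : ChartAt F q)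

lemma range_eq : Set.range c.toHom = {y | y ⤳ q} := by
  rw [Hom.range_eq_setOf_specializes c.isOpenImmersion, c.map_closedPoint]

end ChartAt

/-- A compact monoidal space with charts at all points is a fine and saturated Kato fan. The image
of any open immersion of a spectrum is the smallest neighbourhood of a point, and thus the image of
a chart. -/
lemma isFSKatoFan_of_chartAt {F : MonoidalSpace.{u}} (hF : CompactSpace F)
    (h : ∀ q, Nonempty (ChartAt F q)) : IsFSKatoFan F where
  isSharp q := by
    obtain ⟨c⟩ := h q
    obtain ⟨N, _, j, hj, rfl⟩ := c
    let e := Units.mapEquiv (MulEquiv.ofBijective (j.stalkMap (closedPoint N)) (hj.isStrict _))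
    exact e.injective.subsingleton
  exists_affine q := by
    obtain ⟨c⟩ := h q
    exact ⟨c.N, _, c.toHom, c.isOpenImmersion, _, c.map_closedPoint⟩
  compactSpace := hF
  affine_fs P _ j hj := by
    obtain ⟨c⟩ := h (j (closedPoint P))
    exact ⟨c.N, _, c.toHom, c.isFS, c.isOpenImmersion,
      c.range_eq.trans (Hom.range_eq_setOf_specializes hj).symm⟩

/-- Finitely many sections detect the points and the stalks of a fan near `q`: two morphisms which
agree at a point agree near that point. -/
lemma ChartAt.eventually_agreeAt {X : MonoidalSpace.{v}} {F : MonoidalSpace.{u}} {f g : Hom X F}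
    {x : X} (c : ChartAt F (f x)) (h : Hom.AgreeAt f g x) : ∀ᶠ z in 𝓝 x, Hom.AgreeAt f g z := by
  obtain ⟨N, hN, j, hj, hq⟩ := c
  have hg : Continuous g := g.continuous_toFun
  have hf : Continuous f := f.continuous_toFun
  -- sections `s a` of the fan, for `a ∈ N`, which correspond to `a` on all of `Spec N`
  choose s hs hs' using Hom.exists_section_of_element hj.isStrict
  have hmul : ∀ a b, ∀ y ∈ Set.range j, s (a * b) y = s a y * s b y := by
    rintro a b _ ⟨z, rfl⟩
    exact (hj.isStrict z).1 (by rw [map_mul, hs', hs', hs', map_mul])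
  have hone : ∀ y ∈ Set.range j, s 1 y = 1 := by
    rintro _ ⟨z, rfl⟩
    exact (hj.isStrict z).1 (by rw [map_one, hs', map_one])
  have hunit : ∀ z a, ∀ y, y = j z → (IsUnit (s a y) ↔ a ∈ z.face) := by
    rintro z a _ rfl
    rw [← j.isUnit_stalkMap, hs', isUnit_toStalk]
  have hsurj : ∀ (t : ∀ y, F.stalk y) z, ∃ a, ∀ y, y = j z → t y = s a y := by
    intro t z
    obtain ⟨a, ha⟩ := z.toStalk_surjective (j.stalkMap z (t (j z)))
    refine ⟨a, ?_⟩
    rintro _ rfl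
    exact (hj.isStrict z).1 (by rw [hs', ha])
  rw [hq] at hs
  obtain ⟨S, hS⟩ := hN.fg.fg_top
  -- the pullbacks of the sections given by the finitely many generators agree near `x`
  have h1 : ∀ᶠ z in 𝓝 x, ∀ a ∈ S, f.stalkMap z (s a (f z)) = g.stalkMap z (s a (g z)) := by
    refine (Filter.eventually_all_finset S).mpr fun a _ => ?_
    exact X.sheaf.eventually_eq (f.map_section x _ (hs a)) (g.map_section x _ (h.1 ▸ hs a))
      (h.2 (s a))
  have hr : ∀ᶠ y in 𝓝 (f x), y ∈ Set.range j := hq ▸ Hom.eventually_mem_range hj _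
  have hr' : ∀ᶠ y in 𝓝 (g x), y ∈ Set.range j := h.1 ▸ hr
  filter_upwards [h1, hf.continuousAt.eventually hr, hg.continuousAt.eventually hr'] with z h2 h3 h4
  have h5 : ∀ a, f.stalkMap z (s a (f z)) = g.stalkMap z (s a (g z)) := by
    intro a
    have ha : a ∈ Submonoid.closure (S : Set N) := hS ▸ Submonoid.mem_top a
    induction ha using Submonoid.closure_induction with
    | mem a ha => exact h2 a ha
    | one => rw [hone _ h3, hone _ h4, map_one, map_one]
    | mul a b _ _ ha hb => rw [hmul _ _ _ h3, hmul _ _ _ h4, map_mul, map_mul, ha, hb]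
  -- a point of `Spec N` is given by the elements which are invertible there
  obtain ⟨p, hp⟩ := h3
  obtain ⟨p', hp'⟩ := h4
  have h6 : p = p' := by
    refine PrimeIdeal.ext (Set.ext fun a => not_iff_not.mp ?_)
    have h7 := hunit p a _ hp.symm
    rw [← f.isUnit_stalkMap, h5, g.isUnit_stalkMap, hunit p' a _ hp'.symm] at h7
    exact h7.symm
  refine ⟨by rw [← hp, h6, hp'], fun t => ?_⟩
  obtain ⟨a, ha⟩ := hsurj t p
  rw [ha _ hp.symm, ha _ (h6 ▸ hp'.symm), h5]

/-- A point `y` of the smallest neighbourhood of `q` is determined by the set of germs of sections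
at `q` which are invertible at `y`. -/
lemma ChartAt.eq_of_isUnit_iff {F : MonoidalSpace.{u}} {q : F} (c : ChartAt F q) {y y' : F}
    (hy : y ⤳ q) (hy' : y' ⤳ q)
    (h : ∀ s, F.sheaf.IsSectionAt q s → (IsUnit (s y) ↔ IsUnit (s y'))) : y = y' := by
  obtain ⟨N, hN, j, hj, rfl⟩ := c
  choose s hs hs' using Hom.exists_section_of_element hj.isStrict
  have hunit : ∀ z a, IsUnit (s a (j z)) ↔ a ∈ z.face := fun z a => by
    rw [← j.isUnit_stalkMap, hs', isUnit_toStalk]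
  rw [← Set.mem_ofPred_eq (p := fun y => y ⤳ _),
    ← Hom.range_eq_setOf_specializes hj] at hy hy'
  obtain ⟨p, rfl⟩ := hy
  obtain ⟨p', rfl⟩ := hy'
  refine congrArg j (PrimeIdeal.ext (Set.ext fun a => not_iff_not.mp ?_))
  exact (hunit p a).symm.trans ((h _ (hs a)).trans (hunit p' a))

lemma ChartAt.hom_ext {P : Type v} [CommMonoid P] {F : MonoidalSpace.{u}} {f g : Hom (Spec P) F}
    (c : ChartAt F (f (closedPoint P))) (h : Hom.AgreeAt f g (closedPoint P)) : f = g :=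
  Hom.ext_agreeAt (eventually_closedPoint.mp (c.eventually_agreeAt h))

/-- A morphism from the spectrum of a sharp monoid to a Kato fan factors through a chart by a
homomorphism of monoids if it takes the closed point to the image of the chart. -/
lemma ChartAt.exists_eq_comp {P : Type v} [CommMonoid P] [Subsingleton Pˣ]
    {F : MonoidalSpace.{u}} {f : Hom (Spec P) F} (c : ChartAt F (f (closedPoint P)))
    {N : Type w} [CommMonoid N] {j : Hom (Spec N) F} (hj : j.IsStrict)
    (hf : f (closedPoint P) ∈ Set.range j) : ∃ θ : N →* P, f = j.comp (Spec.map θ) := by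
  obtain ⟨n, hn⟩ := hf
  let e := MulEquiv.ofBijective (closedPoint P).toStalk toStalk_closedPoint_bijective
  have he : ∀ m, (closedPoint P).toStalk (e.symm m) = m := e.apply_symm_apply
  obtain ⟨θ, h1, h2⟩ := Hom.exists_of_localHom hj hn
    (e.symm.toMonoidHom.comp (f.stalkMap (closedPoint P))) ⟨fun m hm => by
      refine f.isUnit_stalkMap.mp ?_
      rw [← he (f.stalkMap _ m)]
      exact hm.map _⟩
  exact ⟨θ, c.hom_ext ⟨h1.symm, fun s => (he _).symm.trans (h2 s).symm⟩⟩

/-! ### Inverse images of monoidal spaces -/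

namespace MonoidalSpace

/-- The space `E` with the inverse image under `π : E → F` of the structure sheaf of `F`. -/
abbrev inverseImage (F : MonoidalSpace.{u}) {E : Type u} [TopologicalSpace E] (π : E → F)
    (hπ : Continuous π) : MonoidalSpace.{u} where
  carrier := E
  sheaf :=
    { stalk := fun e => F.stalk (π e)
      IsSectionAt := fun e s => ∃ t, F.sheaf.IsSectionAt (π e) t ∧ ∀ᶠ z in 𝓝 e, s z = t (π z)
      eventually_isSectionAt := by
        rintro e s ⟨t, ht, h⟩
        filter_upwards [hπ.continuousAt.eventually (F.sheaf.eventually_isSectionAt ht),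
          h.eventually_nhds] with z h1 h2
        exact ⟨t, h1, h2⟩
      congr := by
        rintro e s s' h ⟨t, ht, h'⟩
        exact ⟨t, ht, by filter_upwards [h, h'] with z h1 h2; rw [← h1, h2]⟩
      exists_section := by
        intro e m
        obtain ⟨t, ht, rfl⟩ := F.sheaf.exists_section m
        exact ⟨fun z => t (π z), ⟨t, ht, .of_forall fun _ => rfl⟩, rfl⟩
      eventually_eq := by
        rintro e s s' ⟨t, ht, h⟩ ⟨t', ht', h'⟩ he
        rw [h.self_of_nhds, h'.self_of_nhds] at he
        filter_upwards [h, h', hπ.continuousAt.eventually (F.sheaf.eventually_eq ht ht' he)]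
          with z h1 h2 h3
        rw [h1, h2, h3]
      isSectionAt_one := fun e => ⟨1, F.sheaf.isSectionAt_one _, .of_forall fun _ => rfl⟩
      isSectionAt_mul := by
        rintro e s s' ⟨t, ht, h⟩ ⟨t', ht', h'⟩
        refine ⟨t * t', F.sheaf.isSectionAt_mul ht ht', ?_⟩
        filter_upwards [h, h'] with z h1 h2
        rw [Pi.mul_apply, Pi.mul_apply, h1, h2] }

variable {F : MonoidalSpace.{u}} {E : Type u} [TopologicalSpace E] {π : E → F}

/-- The strict morphism to `F` from an inverse image. -/
def inverseImage.proj (hπ : Continuous π) : Hom (F.inverseImage π hπ) F where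
  toFun := π
  continuous_toFun := hπ
  stalkMap _ := MonoidHom.id _
  isLocalHom_stalkMap _ := ⟨fun _ h => h⟩
  map_section _ s hs := ⟨s, hs, .of_forall fun _ => rfl⟩

lemma inverseImage.isStrict_proj (hπ : Continuous π) : (inverseImage.proj hπ).IsStrict :=
  fun _ => Function.bijective_id

/-- The morphism of inverse images given by a continuous map over `F`. -/
def inverseImage.map (hπ : Continuous π) {E' : Type u} [TopologicalSpace E'] (k : E' → E)
    (hk : Continuous k) : Hom (F.inverseImage (π ∘ k) (hπ.comp hk)) (F.inverseImage π hπ) where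
  toFun := k
  continuous_toFun := hk
  stalkMap _ := MonoidHom.id _
  isLocalHom_stalkMap _ := ⟨fun _ h => h⟩
  map_section _ _ := fun ⟨t, ht, h⟩ => ⟨t, ht, hk.continuousAt.eventually h⟩

/-- A continuous lift to `E` of the map underlying a morphism `f : X → F` gives a morphism to the
inverse image. -/
def inverseImage.lift {X : MonoidalSpace.{v}} (hπ : Continuous π) (f' : X → E)
    (hf' : Continuous f') (φ : ∀ x, F.stalk (π (f' x)) →* X.stalk x) (hφ : ∀ x, IsLocalHom (φ x))
    (hs : ∀ x s, F.sheaf.IsSectionAt (π (f' x)) s →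
      X.sheaf.IsSectionAt x fun z => φ z (s (π (f' z)))) : Hom X (F.inverseImage π hπ) where
  toFun := f'
  continuous_toFun := hf'
  stalkMap := φ
  isLocalHom_stalkMap := hφ
  map_section x s := fun ⟨t, ht, h⟩ => by
    refine X.sheaf.congr ?_ (hs x t ht)
    filter_upwards [hf'.continuousAt.eventually h] with z hz
    exact congrArg (φ z) hz.symm

end MonoidalSpace

/-- The inverse image of a Kato fan under a local homeomorphism is a Kato fan, if it is compact. -/
lemma IsFSKatoFan.inverseImage {F : MonoidalSpace.{u}} (hF : IsFSKatoFan F) {E : Type u}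
    [TopologicalSpace E] [hE : CompactSpace E] {π : E → F} (hπ : IsLocalHomeomorph π) :
    IsFSKatoFan (F.inverseImage π hπ.continuous) := by
  refine isFSKatoFan_of_chartAt hE fun e => ?_
  obtain ⟨N, hN, j, hj, hq⟩ := hF.chartAt (π e)
  obtain ⟨Φ, heΦ, rfl⟩ := hπ e
  have hr : ∀ p, j p ∈ Φ.target := by
    intro p
    have : j p ⤳ Φ e := hq ▸ (specializes_closedPoint p).map j.continuous_toFun
    exact this.mem_open Φ.open_target (Φ.map_source heΦ)
  have : Nonempty (Spec N) := ⟨closedPoint N⟩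
  -- the chart `j` of `F` composed with the local inverse of `π` near `e`
  let Ψ := (hj.isOpenEmbedding.toOpenPartialHomeomorph j).trans Φ.symm
  have hΨ : Topology.IsOpenEmbedding Ψ := Ψ.isOpenEmbedding (by
    ext p
    simpa [Ψ] using hr p)
  obtain ⟨g, hg, hg'⟩ := (inverseImage.isStrict_proj hπ.continuous).exists_lift j Ψ hΨ.continuous
    (fun p => Φ.right_inv (hr p))
  refine ⟨{
    N := N
    isFS := hN
    toHom := g
    isOpenImmersion := ⟨by rw [hg]; exact hΨ,
      Hom.IsStrict.of_comp (inverseImage.isStrict_proj hπ.continuous) (hg' ▸ hj.isStrict)⟩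
    map_closedPoint := ?_ }⟩
  rw [hg]
  change Φ.symm (j (closedPoint N)) = e
  rw [hq, Φ.left_inv heΦ]

lemma IsFSKatoFan.isOpen_setOf_specializes {F : MonoidalSpace.{u}} (hF : IsFSKatoFan F) (p : F) :
    IsOpen {y : F | y ⤳ p} := by
  rw [← (hF.chartAt p).range_eq]
  exact (hF.chartAt p).isOpenImmersion.isOpenEmbedding.isOpen_range

/-- The open subsets of a Kato fan are the subsets stable under generization. -/
lemma IsFSKatoFan.isOpen_of_generization {F : MonoidalSpace.{u}} (hF : IsFSKatoFan F) {W : Set F}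
    (h : ∀ p ∈ W, ∀ y, y ⤳ p → y ∈ W) : IsOpen W :=
  isOpen_iff_mem_nhds.mpr fun p hp => Filter.mem_of_superset
    ((hF.isOpen_setOf_specializes p).mem_nhds specializes_rfl) fun y hy => h p hp y hy

/-- If every point of `E` has a smallest neighbourhood, a compact space maps to `E` through a
compact open subset, consisting of the generizations of finitely many points of the image. -/
lemma exists_isOpen_isCompact {X : Type v} [TopologicalSpace X] [CompactSpace X] {E : Type u}
    [TopologicalSpace E] {f : X → E} (hf : Continuous f)
    (hE : ∀ e : E, IsOpen {y : E | y ⤳ e}) :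
    ∃ V : Set E, IsOpen V ∧ IsCompact V ∧ (∀ x, f x ∈ V) ∧ ∀ y ∈ V, ∃ x, y ⤳ f x := by
  obtain ⟨T, hT⟩ := isCompact_univ.elim_finite_subcover (fun x => f ⁻¹' {y | y ⤳ f x})
    (fun x => (hE (f x)).preimage hf) (fun x _ => Set.mem_iUnion.mpr ⟨x, specializes_rfl⟩)
  refine ⟨⋃ x ∈ T, {y | y ⤳ f x}, isOpen_biUnion fun x _ => hE (f x), ?_, ?_, ?_⟩
  · refine T.isCompact_biUnion fun x _ => ?_
    -- every neighbourhood of `f x` contains all its generizations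
    intro l _ hl
    refine ⟨f x, specializes_rfl, ?_⟩
    refine Filter.neBot_of_le (f := l) (le_inf ?_ le_rfl)
    refine hl.trans fun s hs => Filter.mem_principal.mpr fun y hy => ?_
    exact mem_of_mem_nhds (hy hs)
  · intro x
    simpa using hT (Set.mem_univ x)
  · intro y hy
    simp only [Set.mem_iUnion] at hy
    obtain ⟨x, -, hx⟩ := hy
    exact ⟨x, hx⟩

/-! ### The space of germs of morphisms between Kato fans -/

variable (F G : MonoidalSpace.{u})

/-- The smallest neighbourhood of a point `p` of a Kato fan, the set of generizations of `p`. -/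
abbrev minNhd (p : F) : MonoidalSpace.{u} :=
  F.inverseImage (Subtype.val : {y : F // y ⤳ p} → F) continuous_subtype_val

variable {F G}

/-- The point `p` of its smallest neighbourhood. -/
abbrev minNhd.pt (p : F) : minNhd F p := (⟨p, specializes_rfl⟩ : {y : F // y ⤳ p})

/-- The inclusion of smallest neighbourhoods. -/
def minNhd.incl {p p' : F} (h : p' ⤳ p) : Hom (minNhd F p') (minNhd F p) :=
  inverseImage.lift continuous_subtype_val
    (fun y : minNhd F p' => (⟨y.1, y.2.trans h⟩ : {y : F // y ⤳ p}))
    (continuous_subtype_val.subtype_mk _) (fun _ => MonoidHom.id _) (fun _ => ⟨fun _ h => h⟩)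
    fun _ s hs => ⟨s, hs, .of_forall fun _ => rfl⟩

lemma minNhd.specializes_pt {p : F} (y : minNhd F p) : y ⤳ minNhd.pt p :=
  Topology.IsInducing.subtypeVal.specializes_iff.mp y.2

lemma minNhd.hom_ext (hG : IsFSKatoFan G) {p : F} {f g : Hom (minNhd F p) G}
    (h : Hom.AgreeAt f g (minNhd.pt p)) : f = g :=
  Hom.ext_agreeAt fun y =>
    (((hG.chartAt _).eventually_agreeAt h).filter_mono (minNhd.specializes_pt y)).self_of_nhds

/-- A local homomorphism of stalks of Kato fans is induced by a morphism on a neighbourhood. -/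
lemma minNhd.exists_hom (hF : IsFSKatoFan F) (hG : IsFSKatoFan G) (p : F) (q : G)
    (h : G.stalk q →* F.stalk p) (hh : IsLocalHom h) : ∃ g : Hom (minNhd F p) G,
      g (pt p) = q ∧ ∀ s : ∀ y, G.stalk y, g.stalkMap (pt p) (s (g (pt p))) = h (s q) := by
  obtain ⟨N, hN, j, hj, rfl⟩ := hF.chartAt p
  let c' := hG.chartAt q
  have hr := Hom.range_eq_setOf_specializes hj
  -- the inverse of the chart is a morphism `l` from the smallest neighbourhood of `p` to `Spec N`
  let f' : minNhd F (j (closedPoint N)) → PrimeIdeal N := fun y =>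
    (show y.1 ∈ Set.range j from hr ▸ y.2).choose
  have hf' : ∀ y, j (f' y) = y.1 := fun y => (show y.1 ∈ Set.range j from hr ▸ y.2).choose_spec
  have hc : Continuous f' := by
    refine hj.isOpenEmbedding.isInducing.continuous_iff.mpr ?_
    exact (continuous_subtype_val (p := fun y => y ⤳ j (closedPoint N))).congr fun y => (hf' y).symm
  obtain ⟨l, hl, hl'⟩ := hj.isStrict.exists_lift
    (inverseImage.proj (F := F) continuous_subtype_val) f' hc hf'
  let e := MulEquiv.ofBijective (closedPoint N).toStalk toStalk_closedPoint_bijective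
  have he : ∀ m, (closedPoint N).toStalk (e.symm m) = m := e.apply_symm_apply
  obtain ⟨θ, h1, h2⟩ := Hom.exists_of_localHom c'.isOpenImmersion.isStrict c'.map_closedPoint
    ((e.symm.toMonoidHom.comp (j.stalkMap (closedPoint N))).comp h) ⟨fun m hm => by
      refine hh.map_nonunit _ (j.isUnit_stalkMap.mp ?_)
      rw [← he (j.stalkMap _ _)]
      exact hm.map _⟩
  generalize c'.toHom.comp (Spec.map θ) = u at h1 h2
  have hlc : l (pt _) = closedPoint N := by
    rw [hl]; exact hj.isOpenEmbedding.injective (hf' _)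
  refine ⟨u.comp l, ?_, fun s => ?_⟩
  · change u (l (pt _)) = q
    rw [hlc, h1]
  · obtain ⟨m, -, hm⟩ := F.sheaf.exists_section (h (s q))
    have h3 : ∀ z, z = closedPoint N → u.stalkMap z (s (u z)) = j.stalkMap z (m (j z)) := by
      rintro _ rfl
      refine (h2 s).trans ((he _).trans ?_)
      rw [hm]
    refine (congrArg (l.stalkMap _) (h3 _ hlc)).trans ?_
    exact ((Hom.AgreeAt.of_eq hl' (pt _)).2 m).trans hm

variable (F G)

/-- The étalé space of the sheaf of morphisms from open subsets of a Kato fan `F` to `G`. A germ of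
a morphism at `p` is a morphism on the smallest neighbourhood of `p`. -/
structure GermSpace where
  pt : F
  hom : Hom (minNhd F pt) G

variable {F G}

namespace GermSpace

/-- The germ at a generization `p` of the base point of `e`. -/
def restrict (e : GermSpace F G) {p : F} (h : p ⤳ e.pt) : GermSpace F G :=
  ⟨p, e.hom.comp (minNhd.incl h)⟩

/-- A set of germs is open if it contains the germs at generizations. This is the topology of the
étalé space, since the open subsets of a Kato fan are the subsets stable under generization. -/
instance : TopologicalSpace (GermSpace F G) where
  IsOpen W := ∀ e ∈ W, ∀ (p : F) (h : p ⤳ e.pt), e.restrict h ∈ W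
  isOpen_univ := fun _ _ _ _ => trivial
  isOpen_inter := fun _ _ h h' e he p hp => ⟨h e he.1 p hp, h' e he.2 p hp⟩
  isOpen_sUnion := fun _ h e ⟨W, hW, he⟩ p hp => ⟨W, hW, h W hW e he p hp⟩

/-- The smallest neighbourhood of a germ. -/
def nhd (e : GermSpace F G) : Set (GermSpace F G) :=
  {e' | ∃ (p : F) (h : p ⤳ e.pt), e' = e.restrict h}

lemma isOpen_nhd (e : GermSpace F G) : IsOpen e.nhd := by
  rintro _ ⟨p, h, rfl⟩ p' h'
  exact ⟨p', h'.trans h, rfl⟩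

lemma mem_nhd (e : GermSpace F G) : e ∈ e.nhd := ⟨e.pt, specializes_rfl, rfl⟩

lemma restrict_specializes (e : GermSpace F G) {p : F} (h : p ⤳ e.pt) : e.restrict h ⤳ e :=
  specializes_iff_forall_open.mpr fun _ hs he => hs e he p h

lemma nhd_eq (e : GermSpace F G) : e.nhd = {e' | e' ⤳ e} := by
  refine Set.Subset.antisymm ?_ fun e' he => he.mem_open e.isOpen_nhd e.mem_nhd
  rintro _ ⟨p, h, rfl⟩
  exact e.restrict_specializes h

lemma continuous_pt : Continuous (pt : GermSpace F G → F) :=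
  ⟨fun _ hW _ he _ h => h.mem_open hW he⟩

lemma isLocalHomeomorph_pt (hF : IsFSKatoFan F) : IsLocalHomeomorph (pt : GermSpace F G → F) := by
  refine isLocalHomeomorph_iff_isOpenEmbedding_restrict.mpr fun e => ?_
  refine ⟨e.nhd, e.isOpen_nhd.mem_nhds e.mem_nhd, ?_⟩
  refine .of_continuous_injective_isOpenMap (continuous_pt.comp continuous_subtype_val) ?_ ?_
  · rintro ⟨_, p, h, rfl⟩ ⟨_, p', h', rfl⟩ (rfl : p = p')
    rfl
  · intro U hU
    refine hF.isOpen_of_generization ?_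
    rintro _ ⟨⟨e', he'⟩, hU', rfl⟩ p hp
    have h := e'.restrict_specializes hp
    exact ⟨⟨e'.restrict hp, h.mem_open e.isOpen_nhd he'⟩,
      (Topology.IsInducing.subtypeVal.specializes_iff.mp h).mem_open hU hU', rfl⟩

/-- The tautological morphism, which evaluates a germ. -/
def eval : Hom (F.inverseImage (pt : GermSpace F G → F) continuous_pt) G where
  toFun e := e.hom (minNhd.pt e.pt)
  continuous_toFun := ⟨fun W hW e he p h => by
    have h1 : e.hom (minNhd.incl h (minNhd.pt p)) ⤳ e.hom (minNhd.pt e.pt) :=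
      (minNhd.specializes_pt _).map e.hom.continuous_toFun
    exact h1.mem_open hW he⟩
  stalkMap e := e.hom.stalkMap (minNhd.pt e.pt)
  isLocalHom_stalkMap e := e.hom.isLocalHom_stalkMap _
  map_section e s hs := by
    obtain ⟨t, ht, h⟩ := e.hom.map_section (minNhd.pt e.pt) s hs
    refine ⟨t, ht, ?_⟩
    filter_upwards [e.isOpen_nhd.mem_nhds e.mem_nhd]
    rintro _ ⟨p, hp, rfl⟩
    exact (h.filter_mono (minNhd.specializes_pt (minNhd.incl hp (minNhd.pt p)))).self_of_nhds

end GermSpace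

/-! ### Functoriality of the initial strict morphism to a Kato fan -/

section Universal

variable {Z F G : MonoidalSpace.{u}} {φ : Hom Z F}

/-- If `φ : Z → F` is strict, then `ψ : Z → G` factors through `φ` near every point of `Z`. The
germs of the morphisms `F → G` which occur define a continuous map `f` from `Z` to the étalé space;
any morphism `Φ` with underlying map `f` that lies over `φ` recovers `ψ` by evaluation of
germs. -/
lemma exists_lift_germSpace (hF : IsFSKatoFan F) (hG : IsFSKatoFan G) (hφ : φ.IsStrict)
    (ψ : Hom Z G) :
    ∃ f : Z → GermSpace F G, Continuous f ∧ (∀ x, (f x).pt = φ x) ∧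
      ∀ Φ : Hom Z (F.inverseImage GermSpace.pt (GermSpace.continuous_pt (F := F) (G := G))),
        Φ.toFun = f → (inverseImage.proj GermSpace.continuous_pt).comp Φ = φ →
          GermSpace.eval.comp Φ = ψ := by
  let e (x : Z) := MulEquiv.ofBijective (φ.stalkMap x) (hφ x)
  have he : ∀ x m, φ.stalkMap x ((e x).symm m) = m := fun x m => (e x).apply_symm_apply m
  have key (x : Z) := minNhd.exists_hom hF hG (φ x) (ψ x)
    ((e x).symm.toMonoidHom.comp (ψ.stalkMap x)) ⟨fun m hm => by
      refine ψ.isUnit_stalkMap.mp ?_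
      rw [← he x (ψ.stalkMap x m)]
      exact IsUnit.map (φ.stalkMap x) hm⟩
  choose g hg hg' using key
  have hg'' : ∀ x (s : ∀ y, G.stalk y), φ.stalkMap x ((g x).stalkMap (minNhd.pt (φ x)) (s _)) =
      ψ.stalkMap x (s (ψ x)) := fun x s => (congrArg (φ.stalkMap x) (hg' x s)).trans (he x _)
  refine ⟨fun x => ⟨φ x, g x⟩, ?_, fun _ => rfl, ?_⟩
  · refine continuous_iff_continuousAt.mpr fun x => ?_
    refine Filter.tendsto_def.mpr fun W hW => ?_
    obtain ⟨W', hW', hWo, hxW⟩ := mem_nhds_iff.mp hW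
    -- `g x` and `ψ` agree near `x`, as they agree at `x`
    let A : Set Z := {z | φ z ⤳ φ x}
    have hA : IsOpen A := (hF.isOpen_setOf_specializes (φ x)).preimage φ.continuous_toFun
    let i : Hom (Z.inverseImage (Subtype.val : A → Z) continuous_subtype_val) Z :=
      inverseImage.proj continuous_subtype_val
    let φA : Hom (Z.inverseImage (Subtype.val : A → Z) continuous_subtype_val)
        (minNhd F (φ x)) :=
      inverseImage.lift continuous_subtype_val
        (fun y : A => (⟨φ y.1, y.2⟩ : {y : F // y ⤳ φ x}))
        ((φ.continuous_toFun.comp continuous_subtype_val).subtype_mk _)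
        (fun y => φ.stalkMap y.1) (fun y => φ.isLocalHom_stalkMap y.1)
        fun y s hs => ⟨_, φ.map_section y.1 s hs, .of_forall fun _ => rfl⟩
    have h1 : Hom.AgreeAt ((g x).comp φA) (ψ.comp i) (⟨x, specializes_rfl⟩ : A) :=
      ⟨hg x, hg'' x⟩
    have h2 := (hG.chartAt _).eventually_agreeAt h1
    have h3 := (hA.isOpenEmbedding_subtypeVal.isOpenMap.image_mem_nhds h2)
    filter_upwards [h3]
    rintro _ ⟨⟨z, hz⟩, h4, rfl⟩
    -- germs at `φ z` with equal homomorphisms of stalks are equal, so `g z` is the restriction of `g x`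
    have h5 : g z = (g x).comp (minNhd.incl hz) := by
      refine minNhd.hom_ext hG ⟨(hg z).trans h4.1.symm, fun s => (hφ z).1 ?_⟩
      exact (hg'' z s).trans (h4.2 s).symm
    refine hW' ?_
    change (⟨φ z, g z⟩ : GermSpace F G) ∈ W'
    rw [h5]
    exact hWo _ hxW (φ z) hz
  · rintro ⟨_, hΦ, ρ, hρ, hρ'⟩ rfl h
    refine Hom.ext_agreeAt fun x => ⟨hg x, fun s => ?_⟩
    obtain ⟨m, -, hm⟩ := F.sheaf.exists_section ((g x).stalkMap (minNhd.pt (φ x)) (s _))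
    have h1 := (Hom.AgreeAt.of_eq h x).2 m
    refine Eq.trans ?_ (hg'' x s)
    refine (congrArg (ρ x) hm).symm.trans (h1.trans (congrArg (φ.stalkMap x) hm))

variable [CompactSpace Z]

/-- The generizations of the points of the image form an open subfan, which has to be the whole fan
by the universal property. -/
lemma exists_specializes_of_universal (hF : IsFSKatoFan F)
    (huniv : ∀ (F' : MonoidalSpace.{u}) (ψ : Hom Z F'), IsFSKatoFan F' → ψ.IsStrict →
      ∃! g : Hom F F', g.IsStrict ∧ g.comp φ = ψ)
    (hφ : φ.IsStrict) (y : F) : ∃ x, y ⤳ φ x := by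
  obtain ⟨V, hVo, hVc, hV, hV'⟩ :=
    exists_isOpen_isCompact φ.continuous_toFun hF.isOpen_setOf_specializes
  have : CompactSpace V := isCompact_iff_compactSpace.mp hVc
  have hi := hVo.isOpenEmbedding_subtypeVal.isLocalHomeomorph
  let i := inverseImage.proj hi.continuous
  obtain ⟨φ', -, hφ'⟩ := (inverseImage.isStrict_proj hi.continuous).exists_lift φ
    (fun x => (⟨φ x, hV x⟩ : V)) (φ.continuous_toFun.subtype_mk _) fun _ => rfl
  have hφ'' := Hom.IsStrict.of_comp (inverseImage.isStrict_proj hi.continuous) (hφ'.symm ▸ hφ)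
  obtain ⟨g, ⟨hg, hg'⟩, -⟩ := huniv _ φ' (hF.inverseImage hi) hφ''
  have h1 : i.comp g = Hom.id F := (huniv F φ hF hφ).unique
    ⟨(inverseImage.isStrict_proj hi.continuous).comp hg,
      (congrArg (Hom.comp i) hg').trans hφ'⟩ ⟨fun _ => Function.bijective_id, rfl⟩
  have h2 : (g y : V).1 = y := (Hom.AgreeAt.of_eq h1 y).1
  exact hV' y (h2 ▸ (g y : V).2)

/-- An initial object among the strict morphisms from `Z` to Kato fans is initial among all
morphisms from `Z` to Kato fans. -/
lemma existsUnique_hom_of_universal (hF : IsFSKatoFan F) (hG : IsFSKatoFan G)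
    (huniv : ∀ (F' : MonoidalSpace.{u}) (ψ : Hom Z F'), IsFSKatoFan F' → ψ.IsStrict →
      ∃! g : Hom F F', g.IsStrict ∧ g.comp φ = ψ)
    (hφ : φ.IsStrict) (ψ : Hom Z G) :
    ∃! g : Hom F G, g.comp φ = ψ := by
  refine existsUnique_of_exists_of_unique ?_ ?_
  · obtain ⟨f, hf, hf', h⟩ := exists_lift_germSpace hF hG hφ ψ
    have hpt := GermSpace.isLocalHomeomorph_pt (G := G) hF
    obtain ⟨V, hVo, hVc, hV, -⟩ := exists_isOpen_isCompact hf fun e => by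
      rw [← GermSpace.nhd_eq]; exact e.isOpen_nhd
    have : CompactSpace V := isCompact_iff_compactSpace.mp hVc
    have hi := hVo.isOpenEmbedding_subtypeVal.isLocalHomeomorph
    let i := inverseImage.map hpt.continuous (Subtype.val : V → _) hi.continuous
    have hs := inverseImage.isStrict_proj (hpt.comp hi).continuous
    obtain ⟨φ', hφ', hφ''⟩ := hs.exists_lift φ
      (fun x => (⟨f x, hV x⟩ : V)) (hf.subtype_mk _) hf'
    obtain ⟨g, ⟨-, hg⟩, -⟩ := huniv _ φ' (hF.inverseImage (hpt.comp hi))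
      (Hom.IsStrict.of_comp hs (hφ''.symm ▸ hφ))
    refine ⟨(GermSpace.eval.comp i).comp g, ?_⟩
    refine Eq.trans ?_ (h (i.comp φ') ?_ hφ'')
    · exact congrArg (Hom.comp (GermSpace.eval.comp i)) hg
    · exact congrArg (fun k : Z → V => fun x => (k x).1) hφ'
  · intro g g' h h'
    refine Hom.ext_agreeAt fun y => ?_
    obtain ⟨x, hx⟩ := exists_specializes_of_universal hF huniv hφ y
    have h1 : Hom.AgreeAt g g' (φ x) :=
      .of_comp_right (hφ x).1 (.of_eq (h.trans h'.symm) x)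
    exact (((hG.chartAt _).eventually_agreeAt h1).filter_mono hx).self_of_nhds

end Universal

namespace FSLogScheme

variable {k : Type u} [Field k]

instance (X : FSLogScheme k) : CompactSpace X.scheme :=
  have := X.quasiCompact
  QuasiCompact.compactSpace_of_compactSpace X.toSpec

/-- Every morphism from `(X, M_X/M_X^*)` to a Kato fan factors through the characteristic
morphism. -/
lemma CharacteristicMorphism.existsUnique {X : FSLogScheme k} (C : CharacteristicMorphism X)
    {G : MonoidalSpace.{u}} (hG : IsFSKatoFan G) (ψ : Hom X.barM G) :
    ∃! g : Hom C.fan G, g.comp C.toFan = ψ :=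
  have : CompactSpace X.barM := inferInstanceAs (CompactSpace X.scheme)
  existsUnique_hom_of_universal C.isFSKatoFan hG C.universal C.isStrict ψ

/-- The morphism of Kato fans induced by a morphism of logarithmic schemes. -/
def Mor.fan {X Y : FSLogScheme k} (C : CharacteristicMorphism X) (D : CharacteristicMorphism Y)
    (f : Mor X Y) : Hom C.fan D.fan :=
  (C.existsUnique D.isFSKatoFan (D.toFan.comp f.barM)).choose

namespace Mor

variable {X Y Z : FSLogScheme k} (C : CharacteristicMorphism X) (D : CharacteristicMorphism Y)
  (E : CharacteristicMorphism Z) (f : Mor X Y) (g : Mor Y Z)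

lemma comp_toFan_eq_iff (h : Hom C.fan D.fan) :
    h.comp C.toFan = D.toFan.comp f.barM ↔ h = f.fan C D := by
  have h1 := (C.existsUnique D.isFSKatoFan (D.toFan.comp f.barM)).choose_spec
  exact ⟨fun h' => h1.2 h h', fun h' => h' ▸ h1.1⟩

lemma fan_comp_φ : (f.fan C D).comp C.φ = D.φ.comp f.barO := by
  have h1 := (f.comp_toFan_eq_iff C D _).mpr rfl
  have h2 : f.barM.comp X.barOToBarM = Y.barOToBarM.comp f.barO := by
    refine Hom.ext_agreeAt fun x => ⟨rfl, fun s => ?_⟩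
    change barMap (X.log.α x) (barMap (f.flat x) (s (f.hom x))) =
      barMap _ (barMap (Y.log.α (f.hom x)) (s (f.hom x)))
    induction s (f.hom x) using Quotient.inductionOn with
    | h a => exact congrArg Associates.mk (f.α_flat x a)
  calc (f.fan C D).comp C.φ = ((f.fan C D).comp C.toFan).comp X.barOToBarM := rfl
    _ = D.toFan.comp (f.barM.comp X.barOToBarM) := by rw [h1]; rfl
    _ = D.φ.comp f.barO := by rw [h2]; rfl

lemma barM_id : (Mor.id X).barM = Hom.id X.barM := by
  refine Hom.ext_agreeAt fun x => ⟨rfl, fun s => ?_⟩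
  change barMap (MonoidHom.id _) (s x) = s x
  induction s x using Quotient.inductionOn with
  | h a => rfl

lemma barM_comp : (g.comp f).barM = g.barM.comp f.barM := by
  refine Hom.ext_agreeAt fun x => ⟨rfl, fun s => ?_⟩
  change barMap ((f.flat x).comp (g.flat _)) (s (g.hom (f.hom x))) =
    barMap (f.flat x) (barMap (g.flat _) (s (g.hom (f.hom x))))
  induction s (g.hom (f.hom x)) using Quotient.inductionOn with
  | h a => rfl

lemma fan_id : (Mor.id X).fan C C = Hom.id C.fan :=
  (((Mor.id X).comp_toFan_eq_iff C C _).mp (by rw [barM_id]; rfl)).symm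

lemma fan_comp : (g.comp f).fan C E = (g.fan D E).comp (f.fan C D) := by
  refine (((g.comp f).comp_toFan_eq_iff C E _).mp ?_).symm
  rw [barM_comp]
  calc ((g.fan D E).comp (f.fan C D)).comp C.toFan
      = (g.fan D E).comp ((f.fan C D).comp C.toFan) := rfl
    _ = ((g.fan D E).comp D.toFan).comp f.barM := by
      rw [(f.comp_toFan_eq_iff C D _).mpr rfl]; rfl
    _ = E.toFan.comp (g.barM.comp f.barM) := by
      rw [(g.comp_toFan_eq_iff D E _).mpr rfl]; rfl

end Mor

end FSLogScheme

/-! ### Maps of extended cone complexes -/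

namespace ExtCone

variable {F G : MonoidalSpace.{u}}

lemma continuous_cone {P : Type u} [CommMonoid P] {j : Hom (Spec P) F} (hj : j.IsOpenImmersion) :
    @Continuous _ _ (homTopology P) _ (cone j) :=
  continuous_iff_coinduced_le.mpr (le_iSup_of_le P (le_iSup_of_le _ (le_iSup_of_le j
    (le_iSup_of_le hj le_rfl))))

lemma specMap_comp {M : Type u} {N : Type v} {P : Type w} [CommMonoid M] [CommMonoid N]
    [CommMonoid P] (g : N →* P) (f : M →* N) :
    Spec.map (g.comp f) = (Spec.map f).comp (Spec.map g) := by
  refine Hom.ext_agreeAt fun p => ⟨rfl, fun s => ?_⟩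
  obtain ⟨a, ha⟩ := (comap (g.comp f) p).toStalk_surjective (s (comap (g.comp f) p))
  have h1 : PrimeIdeal.stalkMap f (comap g p) (s (comap f (comap g p))) =
      (comap g p).toStalk (f a) :=
    (congrArg (PrimeIdeal.stalkMap f (comap g p)) ha.symm).trans (stalkMap_toStalk f (comap g p) a)
  refine (congrArg (PrimeIdeal.stalkMap (g.comp f) p) ha.symm).trans
    ((stalkMap_toStalk (g.comp f) p a).trans ?_)
  exact ((congrArg (PrimeIdeal.stalkMap g p) h1).trans (stalkMap_toStalk g p (f a))).symm

lemma cone_comp {M : Type u} {N : Type v} [CommMonoid M] [CommMonoid N] (j : Hom (Spec M) F)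
    (θ : M →* N) (h : N →* RBar) :
    cone j (h.comp θ) = (j.comp (Spec.map θ)).comp (Spec.map h) :=
  congrArg (Hom.comp j) (specMap_comp h θ)

/-- A morphism of fans is given by homomorphisms of monoids on the extended cones. -/
lemma isPiecewiseLinear_map (hG : IsFSKatoFan G) (f : Hom F G) : IsPiecewiseLinear (map f) := by
  intro P _ j hP _ hj
  let c := hG.chartAt ((f.comp j) (closedPoint P))
  obtain ⟨θ, hθ⟩ := c.exists_eq_comp c.isOpenImmersion.isStrict
    ⟨_, c.map_closedPoint⟩
  refine ⟨c.N, _, c.toHom, θ, c.isFS, c.sharp, c.isOpenImmersion, fun a => ?_⟩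
  exact (congrArg (fun i => Hom.comp i (Spec.map a)) hθ).trans (cone_comp c.toHom θ a).symm

lemma continuous_map (hG : IsFSKatoFan G) (f : Hom F G) : Continuous (map f) := by
  refine continuous_iSup_dom.mpr fun P => continuous_iSup_dom.mpr fun _ =>
    continuous_iSup_dom.mpr fun j => continuous_iSup_dom.mpr fun hj =>
    continuous_coinduced_dom.mpr ?_
  -- `P` need not be sharp: pass to `P/P^*`
  let π : P →* Associates P := Associates.mkMonoidHom
  let c := hG.chartAt (((f.comp j).comp (Spec.map π)) (closedPoint (Associates P)))
  obtain ⟨θ, hθ⟩ := c.exists_eq_comp c.isOpenImmersion.isStrict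
    ⟨_, c.map_closedPoint⟩
  let _ := homTopology P
  let _ := homTopology c.N
  have h1 : map f ∘ cone j = cone c.toHom ∘ fun h : P →* RBar => (barLift h).comp θ := by
    funext h
    have h2 : h = (barLift h).comp π := by ext a; rfl
    refine Eq.trans ?_ ((congrArg (fun i => Hom.comp i (Spec.map (barLift h))) hθ).trans
      (cone_comp c.toHom θ (barLift h)).symm)
    exact (congrArg (cone (f.comp j)) h2).trans (cone_comp (f.comp j) π (barLift h))
  rw [h1]
  refine (continuous_cone c.isOpenImmersion).comp (continuous_induced_rng.mpr ?_)
  refine continuous_pi fun n => ?_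
  obtain ⟨a, ha⟩ := Associates.mk_surjective (θ n)
  have h3 : (fun h : P →* RBar => ((((barLift h).comp θ) n).toAdd : ℝ≥0∞)) =
      fun h => (h a).toAdd := by
    funext h
    change (barLift h (θ n)).toAdd = _
    rw [← ha]
    rfl
  exact h3 ▸ (continuous_apply a).comp continuous_induced_dom

end ExtCone

/-! ### The function `-log` -/

lemma negLog_eq_toENNReal (t : ℝ≥0) : negLog t = (-ENNReal.log t).toENNReal := by
  unfold negLog
  split_ifs with h
  · simp [h]
  · rw [ENNReal.log_of_nnreal h, ← EReal.coe_neg, EReal.toENNReal_of_ne_top (EReal.coe_ne_top _)]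
    rfl

lemma continuous_negLog : Continuous negLog := by
  rw [funext negLog_eq_toENNReal]
  exact (ENNReal.continuous_log.comp ENNReal.continuous_coe).neg.ereal_toENNReal

lemma negLog_mul {a b : ℝ≥0} (ha : a ≤ 1) (hb : b ≤ 1) :
    negLog (a * b) = negLog a + negLog b := by
  simp only [negLog_eq_toENNReal]
  have h : ∀ {t : ℝ≥0}, t ≤ 1 → 0 ≤ -ENNReal.log t := fun h => by
    rw [EReal.le_neg, neg_zero, ENNReal.log_le_zero_iff]
    exact_mod_cast h
  rw [← EReal.toENNReal_add (h ha) (h hb), ENNReal.coe_mul, ENNReal.log_mul_add, EReal.neg_add]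
  · rfl
  · exact .inr (by simp)
  · exact .inl (by simp)

lemma negLog_eq_top {t : ℝ≥0} : negLog t = ∞ ↔ t = 0 := by
  unfold negLog
  split_ifs with h <;> simp [h]

lemma negLog_eq_zero {t : ℝ≥0} (ht : t ≤ 1) : negLog t = 0 ↔ t = 1 := by
  refine ⟨fun h => ?_, fun h => by simp [negLog, h]⟩
  have h0 : t ≠ 0 := by
    rintro rfl
    simp [negLog] at h
  rw [negLog, if_neg h0] at h
  have h1 : 0 < (t : ℝ) := NNReal.coe_pos.mpr (pos_iff_ne_zero.mpr h0)
  have h2 : Real.log t = 0 := le_antisymm (Real.log_nonpos h1.le (by exact_mod_cast ht))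
    (by simpa using h)
  have h3 := Real.eq_one_of_pos_of_log_eq_zero h1 h2
  exact_mod_cast h3

/-! ### Points of the analytification -/

/-- A multiplicative seminorm bounded by `1` is non-Archimedean: compare `|a + b|^n` with the
binomial expansion for large `n`. -/
lemma seminorm_add_le_max {A : Type u} [CommRing A] (p : MulRingSeminorm A) (hp : ∀ a, p a ≤ 1)
    (a b : A) : p (a + b) ≤ max (p a) (p b) := by
  by_contra! h
  set m := max (p a) (p b)
  have hm : 0 ≤ m := le_max_of_le_left (apply_nonneg p a)
  have hs : 0 < p (a + b) := hm.trans_lt h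
  have key : ∀ n : ℕ, 1 ≤ n * (m / p (a + b)) ^ n + (m / p (a + b)) ^ n := by
    intro n
    have h1 : p (a + b) ^ n ≤ ∑ _i ∈ Finset.range (n + 1), m ^ n := by
      rw [← map_pow, add_pow]
      refine (Finset.le_sum_of_subadditive p (map_zero p).le (map_add_le_add p) _ _).trans
        (Finset.sum_le_sum fun i hi => ?_)
      rw [map_mul, map_mul, map_pow, map_pow]
      have hi' : i ≤ n := Nat.lt_succ_iff.mp (Finset.mem_range.mp hi)
      calc p a ^ i * p b ^ (n - i) * p _ ≤ m ^ i * m ^ (n - i) * 1 := by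
            gcongr
            · exact le_max_left _ _
            · exact le_max_right _ _
            · exact hp _
        _ = m ^ n := by rw [mul_one, ← pow_add, Nat.add_sub_cancel' hi']
    rw [Finset.sum_const, Finset.card_range, nsmul_eq_mul] at h1
    rw [div_pow, ← add_one_mul, mul_div_assoc', le_div_iff₀ (by positivity), one_mul]
    exact_mod_cast h1
  have hr : m / p (a + b) < 1 := (div_lt_one hs).mpr h
  have hr0 : 0 ≤ m / p (a + b) := by positivity
  have hlim := (tendsto_self_mul_const_pow_of_lt_one hr0 hr).add
    (tendsto_pow_atTop_nhds_zero_of_lt_one hr0 hr)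
  have := ge_of_tendsto' hlim key
  norm_num at this

namespace Beth

variable {X : Scheme.{u}}

/-- The value `|a|_x ∈ [0,1]` for `a` in the local ring at the reduction of `x`. -/
def nnnorm (x : Beth X) (a : X.presheaf.stalk x.red) : ℝ≥0 := ⟨x.seminorm a, apply_nonneg _ _⟩

lemma nnnorm_le_one (x : Beth X) (a) : x.nnnorm a ≤ 1 := x.le_one a

lemma nnnorm_mul (x : Beth X) (a b) : x.nnnorm (a * b) = x.nnnorm a * x.nnnorm b :=
  NNReal.eq (map_mul x.seminorm a b)

lemma nnnorm_one (x : Beth X) : x.nnnorm 1 = 1 := NNReal.eq (map_one x.seminorm)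

lemma nnnorm_eq_one_iff (x : Beth X) {a} : x.nnnorm a = 1 ↔ IsUnit a := by
  rw [← not_iff_not, ← x.lt_one_iff, ← Ne, ← (x.nnnorm_le_one a).lt_iff_ne]
  rfl

/-- The seminorm of `x` as a valuation. -/
def valuation (x : Beth X) : Valuation (X.presheaf.stalk x.red) ℝ≥0 where
  toFun := x.nnnorm
  map_zero' := NNReal.eq (map_zero x.seminorm)
  map_one' := x.nnnorm_one
  map_mul' := x.nnnorm_mul
  map_add_le_max' := seminorm_add_le_max x.seminorm x.le_one

lemma ext_germ {x y : Beth X} (h : x.red = y.red)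
    (h' : ∀ (U : X.Opens) (hx : x.red ∈ U) (hy : y.red ∈ U) (a : Γ(X, U)),
      x.seminorm (X.presheaf.germ U _ hx a) = y.seminorm (X.presheaf.germ U _ hy a)) : x = y := by
  obtain ⟨p, s, hs, hs'⟩ := x
  obtain ⟨q, t, ht, ht'⟩ := y
  obtain rfl : p = q := h
  obtain rfl : s = t := by
    ext m
    obtain ⟨U, hU, a, rfl⟩ := X.presheaf.exists_germ_eq m
    exact h' U hU hU a
  rfl

/-- Every point is represented by a morphism from the spectrum of a valuation ring, that of the
residue field of the kernel of the seminorm. -/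
lemma exists_ofMor_eq (x : Beth X) : ∃ (K : Type u) (_ : Field K) (v : Valuation K ℝ≥0)
    (g : AlgebraicGeometry.Spec (CommRingCat.of v.valuationSubring) ⟶ X), ofMor v g = x := by
  -- `K` is the field of fractions of the local ring at `r(x)` modulo the kernel of the seminorm
  let A := X.presheaf.stalk x.red
  let B := A ⧸ x.valuation.supp
  have hS : nonZeroDivisors B ≤ (x.valuation.onQuot le_rfl).supp.primeCompl := by
    intro b hb hb'
    rw [SetLike.mem_coe, Valuation.supp_quot_supp] at hb'
    exact nonZeroDivisors.ne_zero hb hb'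
  let K := FractionRing B
  let v : Valuation K ℝ≥0 := (x.valuation.onQuot le_rfl).extendToLocalization hS K
  have hv : ∀ a : A, v (algebraMap B K (Ideal.Quotient.mk _ a)) = x.nnnorm a := fun a =>
    Valuation.extendToLocalization_apply_map_apply _ hS K (Ideal.Quotient.mk _ a)
  let f : A →+* v.valuationSubring :=
    ((algebraMap B K).comp (Ideal.Quotient.mk _)).codRestrict v.valuationSubring.toSubring
      fun a => (v.mem_valuationSubring_iff _).mpr ((hv a).trans_le (x.nnnorm_le_one a))
  have hf : ∀ a, v (f a) = x.nnnorm a := hv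
  let f' : X.presheaf.stalk x.red ⟶ CommRingCat.of v.valuationSubring := CommRingCat.ofHom f
  have hloc : IsLocalHom f'.hom := ⟨fun a ha => by
    have h1 := (Valuation.valuationSubring.integers v).isUnit_iff_valuation_eq_one.mp ha
    exact x.nnnorm_eq_one_iff.mp ((hf a).symm.trans h1)⟩
  have hred : (AlgebraicGeometry.Spec.map f' ≫ X.fromSpecStalk x.red)
      (IsLocalRing.closedPoint v.valuationSubring) = x.red := by
    refine (Scheme.Hom.comp_apply _ _ _).trans ?_
    exact (congrArg _ (Spec_closedPoint (f := f'))).trans Scheme.fromSpecStalk_closedPoint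
  refine ⟨K, inferInstance, v, AlgebraicGeometry.Spec.map f' ≫ X.fromSpecStalk x.red,
    ext_germ hred fun U hx hy a => ?_⟩
  have h2 := ConcreteCategory.congr_hom
    (Scheme.germ_stalkClosedPointTo_Spec_fromSpecStalk f' U hx) a
  refine Eq.trans (congrArg (fun b : v.valuationSubring => (v b : ℝ)) h2) ?_
  exact congrArg NNReal.toReal (hf _)

/-- The homomorphism `-log |.|_x` on the local ring at the reduction of `x`. -/
def val (x : Beth X) : X.presheaf.stalk x.red →* RBar where
  toFun a := Multiplicative.ofAdd (negLog (x.nnnorm a))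
  map_one' := by simp [negLog, nnnorm_one]
  map_mul' a b := by
    rw [nnnorm_mul, negLog_mul (x.nnnorm_le_one a) (x.nnnorm_le_one b), ofAdd_add]

lemma isLocalHom_val (x : Beth X) : IsLocalHom x.val := ⟨fun a ha => by
  obtain ⟨b, hb⟩ := ha.exists_right_inv
  exact x.nnnorm_eq_one_iff.mp ((negLog_eq_zero (x.nnnorm_le_one a)).mp (RBar.eq_one_of_mul hb))⟩

/-- A function near `r(x)` is invertible at `ρ(x)` if and only if `|f|_x` is not zero. -/
lemma isUnit_germ_str_iff (x : Beth X) (U : X.Opens) (hx : x.red ∈ U) (hx' : x.str ∈ U)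
    (a : Γ(X, U)) :
    IsUnit (X.presheaf.germ U x.str hx' a) ↔ x.nnnorm (X.presheaf.germ U x.red hx a) ≠ 0 := by
  rw [← X.mem_basicOpen]
  have h1 : x.str ∈ X.basicOpen a ↔ x.ker ∈ X.fromSpecStalk x.red ⁻¹ᵁ X.basicOpen a := Iff.rfl
  rw [h1, Scheme.preimage_basicOpen, Scheme.fromSpecStalk_app hx]
  rw [CommRingCat.comp_apply, CommRingCat.comp_apply, Scheme.basicOpen_res, basicOpen_eq_of_affine]
  refine (and_iff_right hx').trans (not_congr ?_)
  exact ⟨fun h => NNReal.eq h, fun h => congrArg NNReal.toReal h⟩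

lemma str_specializes (x : Beth X) : x.str ⤳ x.red := by
  have h1 := (IsLocalRing.specializes_closedPoint x.ker).map (X.fromSpecStalk x.red).continuous
  rwa [Scheme.fromSpecStalk_closedPoint] at h1

end Beth

namespace FSLogScheme

variable {k : Type u} [Field k]

/-! ### The tropicalization map -/

/-- The point `u` is the tropicalization of `x`: it sends the closed point to `φ(r(x))`, and its
homomorphism of stalks is induced by `-log |.|_x`. -/
def IsTropAt {X : FSLogScheme k} {F : MonoidalSpace.{u}} (φ : Hom X.barO F) (x : Beth X.scheme)
    (u : ExtCone F) : Prop :=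
  u.red = φ x.red ∧ ∀ s : ∀ y, F.stalk y, Hom.stalkMap u closedPt (s u.red) =
    toClosedStalk (barLift x.val (φ.stalkMap x.red (s (φ x.red))))

lemma isComposition_iff {X : FSLogScheme k} {F : MonoidalSpace.{u}} (φ : Hom X.barO F)
    {K : Type u} [Field K] (v : Valuation K ℝ≥0)
    (g : AlgebraicGeometry.Spec (CommRingCat.of v.valuationSubring) ⟶ X.scheme) (u : ExtCone F) :
    X.IsComposition φ v g u ↔ IsTropAt φ (Beth.ofMor v g) u := by
  have h : X.valBar v g = barLift (Beth.ofMor v g).val := by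
    ext m
    induction m using Quotient.inductionOn with
    | h a => rfl
  unfold IsComposition IsTropAt
  rw [h]

lemma isTrop_iff {X : FSLogScheme k} (C : CharacteristicMorphism X)
    {t : Beth X.scheme → ExtCone C.fan} : IsTrop C t ↔ ∀ x, IsTropAt C.φ x (t x) := by
  constructor
  · intro h x
    obtain ⟨K, _, v, g, rfl⟩ := x.exists_ofMor_eq
    exact (isComposition_iff _ v g _).mp (h K v g)
  · intro h K _ v g
    exact (isComposition_iff _ v g _).mpr (h _)

lemma closedPt_eq : closedPt = closedPoint RBar :=
  PrimeIdeal.ext (Set.ext fun _ => not_congr isUnit_iff_eq_one.symm)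

end FSLogScheme

namespace FSLogScheme

variable {k : Type u} [Field k]

/-! ### Existence and uniqueness of the tropicalization -/

section Trop

variable {X : FSLogScheme k} {F : MonoidalSpace.{u}} {φ : Hom X.barO F} {x : Beth X.scheme}
  {u : ExtCone F}

lemma isTropAt_iff : IsTropAt φ x u ↔ Hom.toFun u (closedPoint RBar) = φ x.red ∧
    ∀ s : ∀ y, F.stalk y, Hom.stalkMap u (closedPoint RBar) (s (Hom.toFun u (closedPoint RBar))) =
      (closedPoint RBar).toStalk (barLift x.val (φ.stalkMap x.red (s (φ x.red)))) := by
  have key : ∀ c : PrimeIdeal RBar, c = closedPoint RBar →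
      ((Hom.toFun u c = φ x.red ∧ ∀ s : ∀ y, F.stalk y, Hom.stalkMap u c (s (Hom.toFun u c)) =
        c.toStalk (barLift x.val (φ.stalkMap x.red (s (φ x.red))))) ↔
      (Hom.toFun u (closedPoint RBar) = φ x.red ∧ ∀ s : ∀ y, F.stalk y,
        Hom.stalkMap u (closedPoint RBar) (s (Hom.toFun u (closedPoint RBar))) =
          (closedPoint RBar).toStalk (barLift x.val (φ.stalkMap x.red (s (φ x.red)))))) := by
    rintro _ rfl
    exact Iff.rfl
  exact key _ closedPt_eq

lemma existsUnique_isTropAt (hF : IsFSKatoFan F) (φ : Hom X.barO F) (x : Beth X.scheme) :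
    ∃! u, IsTropAt φ x u := by
  have hloc : IsLocalHom ((barLift x.val).comp (φ.stalkMap x.red)) := ⟨fun m hm => by
    refine φ.isUnit_stalkMap.mp ?_
    change IsUnit (barLift x.val (φ.stalkMap x.red m)) at hm
    generalize φ.stalkMap x.red m = m' at hm
    induction m' using Quotient.inductionOn with
    | h a => exact Associates.isUnit_mk.mpr (x.isLocalHom_val.map_nonunit a hm)⟩
  let c := hF.chartAt (φ x.red)
  obtain ⟨θ, h1, h2⟩ := Hom.exists_of_localHom c.isOpenImmersion.isStrict c.map_closedPoint _ hloc
  refine ⟨c.toHom.comp (Spec.map θ), isTropAt_iff.mpr ⟨h1, h2⟩, fun u hu => ?_⟩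
  obtain ⟨h3, h4⟩ := isTropAt_iff.mp hu
  exact (hF.chartAt _).hom_ext ⟨h3.trans h1.symm, fun s => (h4 s).trans (h2 s).symm⟩

/-- A section of `O_X/O_X^*` is locally represented by a function. -/
lemma exists_germ_of_isSectionAt {x : X.scheme} {s : ∀ y, X.barO.stalk y}
    (hs : X.barO.sheaf.IsSectionAt x s) : ∃ (U : X.scheme.Opens) (_ : x ∈ U) (a : Γ(X.scheme, U)),
      ∀ y (hy : y ∈ U), s y = Associates.mk (X.scheme.presheaf.germ U y hy a) := by
  obtain ⟨t, ⟨U, hx, a, ha⟩, h⟩ := hs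
  obtain ⟨V, hV, hVo, hxV⟩ := eventually_nhds_iff.mp h
  refine ⟨U ⊓ ⟨V, hVo⟩, ⟨hx, hxV⟩, X.scheme.presheaf.map (homOfLE inf_le_left).op a, ?_⟩
  intro y hy
  rw [hV y hy.2, ha y hy.1]
  exact congrArg Associates.mk
    (X.scheme.presheaf.germ_res_apply (homOfLE inf_le_left) y hy a).symm

lemma inftyPt_specializes : inftyPt ⤳ closedPt := closedPt_eq ▸ specializes_closedPoint inftyPt

/-- Both points are generizations of `φ(r(x))`, and a germ of a section of the fan there is
invertible at either of them if and only if its pullback to `X` does not vanish in `x`. -/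
lemma IsTropAt.str_eq (hF : IsFSKatoFan F) (h : IsTropAt φ x u) : u.str = φ x.str := by
  refine (hF.chartAt (φ x.red)).eq_of_isUnit_iff ?_ (x.str_specializes.map φ.continuous_toFun) ?_
  · exact h.1 ▸ inftyPt_specializes.map (Hom.continuous_toFun u)
  · intro s hs
    obtain ⟨U, hx, a, ha⟩ := exists_germ_of_isSectionAt (φ.map_section x.red s hs)
    have hx' : x.str ∈ U := x.str_specializes.mem_open U.isOpen hx
    obtain ⟨h1, h2⟩ := isTropAt_iff.mp h
    have h3 := Hom.exists_eq_toStalk u (h1 ▸ hs) (h2 s) inftyPt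
    have h4 : IsUnit (s (φ x.str)) ↔ x.nnnorm (X.scheme.presheaf.germ U x.red hx a) ≠ 0 := by
      rw [← φ.isUnit_stalkMap, ha _ hx', Associates.isUnit_mk, x.isUnit_germ_str_iff U hx hx']
    have h5 : IsUnit (s u.str) ↔ x.nnnorm (X.scheme.presheaf.germ U x.red hx a) ≠ 0 := by
      refine (Hom.isUnit_stalkMap u (x := inftyPt)).symm.trans ?_
      refine (iff_of_eq (congrArg IsUnit h3)).trans ?_
      rw [isUnit_toStalk, ha _ hx, barLift_mk]
      exact not_congr negLog_eq_top
    exact h5.trans h4.symm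

/-! ### Continuity of the tropicalization -/

/-- On an affine open set, a section of `O_X/O_X^*` is represented on a basic open neighbourhood of
a point by a global function, since the denominators are units there. -/
lemma exists_basicOpen_of_isSectionAt {U : X.scheme.Opens} (hU : IsAffineOpen U) {x : X.scheme}
    (hxU : x ∈ U) {s : ∀ y, X.barO.stalk y} (hs : X.barO.sheaf.IsSectionAt x s) :
    ∃ f b : Γ(X.scheme, U), x ∈ X.scheme.basicOpen f ∧ ∀ y (hy : y ∈ U),
      y ∈ X.scheme.basicOpen f → s y = Associates.mk (X.scheme.presheaf.germ U y hy b) := by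
  obtain ⟨V, hxV, a, ha⟩ := exists_germ_of_isSectionAt hs
  obtain ⟨f, hf, hxf⟩ := hU.exists_basicOpen_le ⟨x, hxV⟩ hxU
  have := hU.isLocalization_basicOpen f
  obtain ⟨⟨b, ⟨_, m, rfl⟩⟩, hb⟩ := IsLocalization.surj (Submonoid.powers f)
    (X.scheme.presheaf.map (homOfLE hf).op a)
  refine ⟨f, b, hxf, fun y hy hyf => ?_⟩
  have h1 := congrArg (X.scheme.presheaf.germ (X.scheme.basicOpen f) y hyf) hb
  have h2 : ∀ c : Γ(X.scheme, U), X.scheme.presheaf.germ (X.scheme.basicOpen f) y hyf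
      (algebraMap Γ(X.scheme, U) Γ(X.scheme, X.scheme.basicOpen f) c) =
        X.scheme.presheaf.germ U y hy c := fun c =>
    X.scheme.presheaf.germ_res_apply (homOfLE (X.scheme.basicOpen_le f)) y hyf c
  rw [map_mul, h2, X.scheme.presheaf.germ_res_apply, map_pow] at h1
  have h3 : IsUnit (X.scheme.presheaf.germ U y hy f ^ m) :=
    ((X.scheme.mem_basicOpen f y hy).mp hyf).pow m
  rw [ha y (hf hyf)]
  exact Associates.mk_eq_mk_iff_associated.mpr
    ((associated_mul_unit_right _ _ h3).trans (.of_eq (h1.trans (h2 b))))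

end Trop

end FSLogScheme

namespace Beth

variable {X : Scheme.{u}} (U : X.Opens)

lemma continuous_eval (b : Γ(X, U)) :
    @Continuous _ _ (domTopology U) _ fun x : Dom U => eval U x b :=
  let _ := domTopology U
  (continuous_apply b).comp (continuous_induced_dom (f := eval U))

/-- The reduction map is anticontinuous: `r(x)` lies in `D(f)` if and only if `|f|_x = 1`. -/
lemma isClosed_setOf_red_mem_basicOpen (f : Γ(X, U)) :
    @IsClosed _ (domTopology U) {x : Dom U | x.1.red ∈ X.basicOpen f} := by
  let _ := domTopology U
  convert isClosed_eq (continuous_eval U f) (continuous_const (y := (1 : ℝ))) using 1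
  ext x
  refine (X.mem_basicOpen f _ x.2).trans (x.1.nnnorm_eq_one_iff.symm.trans ?_)
  exact ⟨fun h => congrArg NNReal.toReal h, fun h => NNReal.eq h⟩

lemma continuous_val (b : Γ(X, U)) : @Continuous _ _ (domTopology U) _
    fun x : Dom U => (x.1.val (X.presheaf.germ U x.1.red x.2 b)).toAdd := by
  let _ := domTopology U
  exact continuous_negLog.comp ((continuous_eval U b).subtype_mk fun x => apply_nonneg _ _)

end Beth

namespace FSLogScheme

variable {k : Type u} [Field k] {X : FSLogScheme k} {F : MonoidalSpace.{u}} {φ : Hom X.barO F}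

/-- The reduction map is anticontinuous. So a point `x` of an affine open set `U` has a
neighbourhood `W` with closed preimage in `U^ℶ`, on which tropicalization is given by finitely many
functions on `U`, those which represent the generators of the monoid of a chart. -/
lemma exists_isClosed_continuousOn (hF : IsFSKatoFan F) {t : Beth X.scheme → ExtCone F}
    (ht : ∀ x, IsTropAt φ x (t x)) {U : X.scheme.Opens} (hU : IsAffineOpen U) {p : X.scheme}
    (hp : p ∈ U) : ∃ W ∈ 𝓝 p, @IsClosed _ (Beth.domTopology U) {x : Beth.Dom U | x.1.red ∈ W} ∧
      @ContinuousOn _ _ (Beth.domTopology U) _ (fun x : Beth.Dom U => t x.1)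
        {x : Beth.Dom U | x.1.red ∈ W} := by
  let _ := Beth.domTopology U
  obtain ⟨N, hN, j, hj, hq⟩ := hF.chartAt (φ p)
  choose s hs hs' using Hom.exists_section_of_element hj.isStrict
  rw [hq] at hs
  choose f b hf hb using fun n => exists_basicOpen_of_isSectionAt hU hp (φ.map_section p _ (hs n))
  obtain ⟨f₀, hf₀, hpf₀⟩ := hU.exists_basicOpen_le
    (V := ⟨φ ⁻¹' Set.range j, hj.isOpenEmbedding.isOpen_range.preimage φ.continuous_toFun⟩)
    ⟨p, (⟨_, hq⟩ : φ p ∈ Set.range j)⟩ hp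
  obtain ⟨S, hS⟩ := hN.fg.fg_top
  let W : Set X.scheme := X.scheme.basicOpen f₀ ∩ ⋂ n ∈ S, X.scheme.basicOpen (f n)
  have hW : IsOpen W := (X.scheme.basicOpen f₀).isOpen.inter
    (isOpen_biInter_finset fun n _ => (X.scheme.basicOpen (f n)).isOpen)
  refine ⟨W, hW.mem_nhds ⟨hpf₀, Set.mem_iInter₂.mpr fun n _ => hf n⟩, ?_, ?_⟩
  · have : {x : Beth.Dom U | x.1.red ∈ W} = {x : Beth.Dom U | x.1.red ∈ X.scheme.basicOpen f₀} ∩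
        ⋂ n ∈ S, {x : Beth.Dom U | x.1.red ∈ X.scheme.basicOpen (f n)} := by
      ext x
      simp [W]
    rw [this]
    exact (Beth.isClosed_setOf_red_mem_basicOpen U f₀).inter
      (isClosed_biInter fun n _ => Beth.isClosed_setOf_red_mem_basicOpen U (f n))
  · rw [continuousOn_iff_continuous_domRestrict]
    have key (x : {x : Beth.Dom U | x.1.red ∈ W}) : ∃ θ : N →* RBar,
        t x.1.1 = ExtCone.cone j θ ∧ ∀ n ∈ S,
          θ n = x.1.1.val (X.scheme.presheaf.germ U x.1.1.red x.1.2 (b n)) := by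
      obtain ⟨⟨x, hxU⟩, hxW⟩ := x
      obtain ⟨h1, h2⟩ := isTropAt_iff.mp (ht x)
      have hr : Hom.toFun (t x) (closedPoint RBar) ∈ Set.range j := h1 ▸ hf₀ hxW.1
      obtain ⟨θ, hθ⟩ := (hF.chartAt _).exists_eq_comp hj.isStrict hr
      refine ⟨θ, hθ, fun n hn => toStalk_closedPoint_bijective.1 ?_⟩
      have h3 : Hom.stalkMap (t x) (closedPoint RBar)
          (s n (Hom.toFun (t x) (closedPoint RBar))) = (closedPoint RBar).toStalk (θ n) := by
        rw [hθ]
        refine (congrArg (PrimeIdeal.stalkMap θ _) (hs' n (comap θ (closedPoint RBar)))).trans ?_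
        exact PrimeIdeal.stalkMap_toStalk θ _ n
      rw [← h3, h2, hb n x.red hxU (Set.mem_iInter₂.mp hxW.2 n hn), barLift_mk]
    choose θ hθ hθ' using key
    let _ := ExtCone.homTopology N
    have h1 : Set.domRestrict {x : Beth.Dom U | x.1.red ∈ W} (fun x : Beth.Dom U => t x.1) =
        ExtCone.cone j ∘ θ := funext hθ
    rw [h1]
    refine (ExtCone.continuous_cone hj).comp (continuous_induced_rng.mpr ?_)
    refine continuous_pi fun n => ?_
    have hn : n ∈ Submonoid.closure (S : Set N) := hS ▸ Submonoid.mem_top n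
    induction hn using Submonoid.closure_induction with
    | mem n hn =>
      exact ((Beth.continuous_val U (b n)).comp continuous_subtype_val).congr fun x =>
        congrArg Multiplicative.toAdd (hθ' x n hn).symm
    | one =>
      exact (continuous_const (y := (0 : ℝ≥0∞))).congr fun x =>
        congrArg Multiplicative.toAdd (map_one (θ x)).symm
    | mul n m _ _ hn hm =>
      exact (hn.add hm).congr fun x => congrArg Multiplicative.toAdd (map_mul (θ x) n m).symm

lemma continuous_of_isTropAt (hF : IsFSKatoFan F) {t : Beth X.scheme → ExtCone F}
    (ht : ∀ x, IsTropAt φ x (t x)) : Continuous t := by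
  refine continuous_iSup_dom.mpr fun U => continuous_iSup_dom.mpr fun hU =>
    continuous_coinduced_dom.mpr ?_
  let _ := Beth.domTopology U
  have key (p : X.scheme) := fun hp : p ∈ U => exists_isClosed_continuousOn hF ht hU hp
  choose! W hW hWc hWt using key
  obtain ⟨T, hT, hTU⟩ := hU.isCompact.elim_nhds_subcover W hW
  refine (locallyFinite_of_finite fun p : T => {x : Beth.Dom U | x.1.red ∈ W p}).continuous
    ?_ (fun p => hWc p (hT p p.2)) (fun p => hWt p (hT p p.2))
  refine Set.eq_univ_of_forall fun x => ?_
  obtain ⟨p, hp, hx⟩ := Set.mem_iUnion₂.mp (hTU x.2)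
  exact Set.mem_iUnion.mpr ⟨⟨p, hp⟩, hx⟩

/-! ### Functoriality of the tropicalization -/

lemma IsTropAt.map {Y : FSLogScheme k} (C : CharacteristicMorphism X)
    (D : CharacteristicMorphism Y) (f : Mor X Y) {x : Beth X.scheme} {u : ExtCone C.fan}
    (h : IsTropAt C.φ x u) :
    IsTropAt D.φ (Beth.map f.hom x) (ExtCone.map (f.fan C D) u) := by
  obtain ⟨h1, h2⟩ := isTropAt_iff.mp h
  obtain ⟨h3, h4⟩ := Hom.AgreeAt.of_eq (f.fan_comp_φ C D) x.red
  refine isTropAt_iff.mpr ⟨(congrArg (f.fan C D) h1).trans h3, fun s => ?_⟩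
  refine (h2 fun y => (f.fan C D).stalkMap y (s (f.fan C D y))).trans ?_
  refine congrArg (closedPoint RBar).toStalk ((congrArg (barLift x.val) (h4 s)).trans ?_)
  have h5 : (barLift x.val).comp (f.barO.stalkMap x.red) = barLift (Beth.map f.hom x).val := by
    ext m
    induction m using Quotient.inductionOn with
    | h a => rfl
  exact DFunLike.congr_fun h5 _

end FSLogScheme

end

end LogTrop

theorem mainTheorem6 (k : Type u) [Field k] :
    -- (i) the tropicalization map is well defined, continuous, and compatible with `r` and `ρ`
    (∀ (X : FSLogScheme k) (C : CharacteristicMorphism X),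
      (∃! t : Beth X.scheme → ExtCone C.fan, IsTrop C t) ∧
      ∀ t : Beth X.scheme → ExtCone C.fan, IsTrop C t →
        Continuous t ∧
        (∀ x : Beth X.scheme, (t x).red = C.φ x.red) ∧
        (∀ x : Beth X.scheme, (t x).str = C.φ x.str)) ∧
    -- (ii) functoriality: `fF f` is the morphism of Kato fans induced by `f`
    ∃ fF : ∀ {X Y : FSLogScheme k} (C : CharacteristicMorphism X) (D : CharacteristicMorphism Y),
        Mor X Y → MonoidalSpace.Hom C.fan D.fan,
      (∀ {X Y : FSLogScheme k} (C : CharacteristicMorphism X) (D : CharacteristicMorphism Y)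
          (f : Mor X Y),
        (∀ g : MonoidalSpace.Hom C.fan D.fan,
          g.comp C.toFan = D.toFan.comp f.barM ↔ g = fF C D f) ∧
        (fF C D f).comp C.φ = D.φ.comp f.barO ∧
        Continuous (ExtCone.map (fF C D f)) ∧
        ExtCone.IsPiecewiseLinear (ExtCone.map (fF C D f)) ∧
        ∀ (t : Beth X.scheme → ExtCone C.fan) (t' : Beth Y.scheme → ExtCone D.fan),
          IsTrop C t → IsTrop D t' →
            ∀ x : Beth X.scheme, ExtCone.map (fF C D f) (t x) = t' (Beth.map f.hom x)) ∧
      (∀ {X : FSLogScheme k} (C : CharacteristicMorphism X),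
        fF C C (Mor.id X) = MonoidalSpace.Hom.id C.fan ∧
        ExtCone.map (fF C C (Mor.id X)) = id) ∧
      (∀ {X Y Z : FSLogScheme k} (C : CharacteristicMorphism X) (D : CharacteristicMorphism Y)
          (E : CharacteristicMorphism Z) (f : Mor X Y) (g : Mor Y Z),
        fF C E (g.comp f) = (fF D E g).comp (fF C D f) ∧
        ExtCone.map (fF C E (g.comp f)) = ExtCone.map (fF D E g) ∘ ExtCone.map (fF C D f)) := by
  refine ⟨fun X C => ⟨?_, fun t ht => ?_⟩, fun C D f => f.fan C D, fun C D f => ?_, fun C => ?_,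
    fun C D E f g => ?_⟩
  · choose t ht ht' using existsUnique_isTropAt C.isFSKatoFan C.φ
    exact ⟨t, (isTrop_iff C).mpr ht, fun t' h => funext fun x => ht' x _ ((isTrop_iff C).mp h x)⟩
  · rw [isTrop_iff] at ht
    exact ⟨continuous_of_isTropAt C.isFSKatoFan ht, fun x => (ht x).1,
      fun x => (ht x).str_eq C.isFSKatoFan⟩
  · refine ⟨f.comp_toFan_eq_iff C D, f.fan_comp_φ C D, ExtCone.continuous_map D.isFSKatoFan _,
      ExtCone.isPiecewiseLinear_map D.isFSKatoFan _, fun t t' ht ht' x => ?_⟩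
    exact (existsUnique_isTropAt D.isFSKatoFan D.φ (Beth.map f.hom x)).unique
      (((isTrop_iff C).mp ht x).map C D f) ((isTrop_iff D).mp ht' _)
  · exact ⟨Mor.fan_id C, congrArg ExtCone.map (Mor.fan_id C)⟩
  · exact ⟨Mor.fan_comp C D E f g, congrArg ExtCone.map (Mor.fan_comp C D E f g)⟩
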